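/- **Setting.** Let $E$ be a finite-dimensional real normed space with norm $\|\cdot\|$, unit ball $B=\{\|x\|\le 1\}$, and conjugate norm $\|\cdot\|_*$ on $E^*$. Let $\theta:B\to\mathbb R$ be continuous and convex with $0\in\operatorname{argmin}_B\theta$. Let $B^o=\{x\in B:\partial\theta(x)\ne\emptyset\}$ and let $\theta'$ be a selection of subgradients of $\theta$ that is continuous on $B^o$ and satisfies $\langle\theta'(x)-\theta'(x'),x-x'\rangle\ge\|x-x'\|^2$ for $x,x'\in B^o$. Set $\Theta=\max_B\theta-\min_B\theta$. Let $X\subset E$ be convex and compact, $x_0\in X$, $R>0$, $\max_{x\in X}\|x-x_0\|\le R$, and put $\vartheta(x)=R^2\theta((x-x_0)/R)$, $\vartheta'(x)=R\,\theta'((x-x_0)/R)$, $V_x(z)=\vartheta(z)-\vartheta(x)-\langle\vartheta'(x),z-x\rangle$. Let $\omega$ be a random variable on a probability space $\Omega$ with distribution $P$, and let $\Phi:X\times\Omega\to\mathbb R$ be such that $\phi(x)=\mathbf E\,\Phi(x,\omega)$ is finite, convex and differentiable on $X$ with $\|\nabla\phi(x')-\nabla\phi(x)\|_*\le L\|x-x'\|$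 for $x,x'\in X$ ($L\ge 0$). Let $\psi$ be convex and continuous on $X$, $F=\phi+\psi$, $F_*=\min_XF$. Let $G:X\times\Omega\to E^*$ be a (measurable) oracle with $\mathbf E\,G(x,\omega)=\nabla\phi(x)$ and $\mathbf E\|G(x,\omega)-\nabla\phi(x)\|_*^2\le\sigma^2$ for all $x\in X$, where $\sigma>0$. Let $\bar x\in X$, $\upsilon\ge0$ and $g(\bar x)\in E^*$ satisfy $\|g(\bar x)-\nabla\phi(\bar x)\|_*\le\upsilon\sigma$. Put $M=LR$. **Algorithm (RSMD with constant step $\bar\beta>0$ and threshold $\lambda$).** For an i.i.d. sample $\omega^N=(\omega_1,\dots,\omega_N)$, $N\ge 1$, and $i=1,\dots,N$, let $$x_i=\operatorname*{argmin}_{z\in X}\{\langle y_i,z\rangle+\psi(z)+\bar\beta V_{x_{i-1}}(z)\},$$ where $y_i=G(x_{i-1},\omega_i)$ if $\|G(x_{i-1},\omega_i)-g(\bar x)\|_*\le L\|\bar x-x_{i-1}\|+\lambda+\upsilon\sigma$, and $y_i=g(\bar x)$ otherwise. Let $\hat x_N=\frac1N\sum_{i=1}^Nx_i$, $x^N=(x_0,\dots,x_N)$,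 and $$\varepsilon(x^N,z)=\sum_{i=1}^N\Big\{\bar\beta^{-1}\big[\langle\nabla\phi(x_{i-1}),x_i-z\rangle+\psi(x_i)-\psi(z)\big]+\tfrac12V_{x_{i-1}}(x_i)\Big\}.$$ **Theorem 1.** There are absolute constants $C,C_1,C_2>0$ such that the following holds in every setting as above. Let $\bar\beta>0$, $\bar\beta\ge2L$, $1\le\tau\le N/\upsilon^2$ (no upper restriction on $\tau$ if $\upsilon=0$), and $\lambda=\max\{\sigma\sqrt{N/\tau},M\}+\upsilon\sigma$. Then there is an event $\mathcal A_N\subset\Omega^{\otimes N}$ of probability at least $1-2e^{-\tau}$ such that for all $\omega^N\in\mathcal A_N$ $$F(\hat x_N)-F_*\le\frac{\bar\beta}{N}\sup_{z\in X}\varepsilon(x^N,z)\le\frac CN\Big(\bar\beta R^2\Theta+R\max\{\sigma\sqrt{\tau N},M\tau\}+\bar\beta^{-1}\max\{N\sigma^2,M^2\tau\}\Big).$$ In particular, if $\bar\beta=\max\Big\{2L,\dfrac{\sigma\sqrt N}{R\sqrt\Theta}\Big\}$, then for all $\omega^N\in\mathcal A_N$, with $\tau\vee\Theta=\max\{\tau,\Theta\}$,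 $$F(\hat x_N)-F_*\le\max\Big\{C_1\frac{LR^2[\tau\vee\Theta]}{N},\;C_2\,\sigma R\sqrt{\frac{\tau\vee\Theta}{N}}\Big\}.$$ -/

import Mathlib

open MeasureTheory

/-- The subdifferential at `x` of a function `θ` on the closed unit ball `B` of `E` (`θ` is regarded
as `+∞` off `B`). -/
def ballSubdifferential {E : Type*} [NormedAddCommGroup E] [NormedSpace ℝ E]
    (θ : E → ℝ) (x : E) : Set (StrongDual ℝ E) :=
  {s | ∀ z ∈ Metric.closedBall (0 : E) 1, θ x + s (z - x) ≤ θ z}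

/-- The set `B°` of the points of the closed unit ball `B` at which `θ` has a subgradient. -/
def ballSubdiffDomain {E : Type*} [NormedAddCommGroup E] [NormedSpace ℝ E]
    (θ : E → ℝ) : Set E :=
  {x | x ∈ Metric.closedBall (0 : E) 1 ∧ (ballSubdifferential θ x).Nonempty}

/-- `θ` is a normalized proxy function on the closed unit ball `B`, and `θ'` is a version of its
subgradient that is continuous on `B°`. Only the values of `θ` on `B` and of `θ'` on `B°` matter. -/
structure IsNormalizedProxy {E : Type*} [NormedAddCommGroup E] [NormedSpace ℝ E]
    (θ : E → ℝ) (θ' : E → StrongDual ℝ E) : Prop where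
  convexOn : ConvexOn ℝ (Metric.closedBall (0 : E) 1) θ
  continuousOn : ContinuousOn θ (Metric.closedBall (0 : E) 1)
  subgradient : ∀ x ∈ ballSubdiffDomain θ, θ' x ∈ ballSubdifferential θ x
  continuousOn_subgradient : ContinuousOn θ' (ballSubdiffDomain θ)
  strongly_monotone : ∀ x ∈ ballSubdiffDomain θ, ∀ x' ∈ ballSubdiffDomain θ,
    ‖x - x'‖ ^ 2 ≤ (θ' x - θ' x') (x - x')
  isMinOn_zero : IsMinOn θ (Metric.closedBall (0 : E) 1) 0

/-- `Θ = max_B θ - min_B θ`, where `B` is the closed unit ball. -/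
noncomputable def proxyRange {E : Type*} [NormedAddCommGroup E] [NormedSpace ℝ E]
    (θ : E → ℝ) : ℝ :=
  sSup (θ '' Metric.closedBall (0 : E) 1) - sInf (θ '' Metric.closedBall (0 : E) 1)

/-- The rescaled proxy function `ϑ(x) = R² θ((x - x₀)/R)`. -/
noncomputable def scaledProxy {E : Type*} [NormedAddCommGroup E] [NormedSpace ℝ E]
    (θ : E → ℝ) (x₀ : E) (R : ℝ) (x : E) : ℝ :=
  R ^ 2 * θ (R⁻¹ • (x - x₀))

/-- The subgradient `ϑ'(x) = R θ'((x - x₀)/R)` of the rescaled proxy function. -/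
noncomputable def scaledProxyGrad {E : Type*} [NormedAddCommGroup E] [NormedSpace ℝ E]
    (θ' : E → StrongDual ℝ E) (x₀ : E) (R : ℝ) (x : E) : StrongDual ℝ E :=
  R • θ' (R⁻¹ • (x - x₀))

/-- The Bregman divergence `V_x(z) = ϑ(z) - ϑ(x) - ⟨ϑ'(x), z - x⟩`. -/
def bregman {E : Type*} [NormedAddCommGroup E] [NormedSpace ℝ E]
    (v : E → ℝ) (v' : E → StrongDual ℝ E) (x z : E) : ℝ :=
  v z - v x - v' x (z - x)

/-- The composite proximal transform
`Prox_{β,x}(ξ) = argmin_{z ∈ X} {⟨ξ, z⟩ + ψ(z) + β V_x(z)}`; for a compact convex `X` and `β > 0`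
the minimizer exists and is unique. -/
noncomputable def compositeProx {E : Type*} [NormedAddCommGroup E] [NormedSpace ℝ E]
    (X : Set E) (ψ : E → ℝ) (v : E → ℝ) (v' : E → StrongDual ℝ E)
    (β : ℝ) (x : E) (ξ : StrongDual ℝ E) : E :=
  Classical.epsilon fun z =>
    z ∈ X ∧ IsMinOn (fun u => ξ u + ψ u + β * bregman v v' x u) X z

/-- The truncated stochastic gradient: `G(x, w)` if
`‖G(x, w) - g‖_* ≤ L ‖xbar - x‖ + lam + υ σ`, and `g` otherwise. -/
noncomputable def truncatedGrad {E : Type*} [NormedAddCommGroup E] [NormedSpace ℝ E]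
    {Ω : Type*} (G : E → Ω → StrongDual ℝ E) (g : StrongDual ℝ E) (xbar : E)
    (L lam υ σ : ℝ) (x : E) (w : Ω) : StrongDual ℝ E :=
  open Classical in
  if ‖G x w - g‖ ≤ L * ‖xbar - x‖ + lam + υ * σ then G x w else g

/-- The mirror descent iterates `x₀, …, x_N` driven by the oracle queries `w₁, …, w_N`:
`x_i = Prox_{β_{i-1}, x_{i-1}}(y(x_{i-1}, w_i))`. The query `w_{i+1}` is `w i` and the parameter
`β_i` is `β i`, for `i : Fin N`. -/
noncomputable def mirrorDescent {E : Type*} [NormedAddCommGroup E] [NormedSpace ℝ E]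
    {Ω : Type*} (X : Set E) (ψ : E → ℝ) (v : E → ℝ) (v' : E → StrongDual ℝ E)
    (y : E → Ω → StrongDual ℝ E) (x₀ : E) {N : ℕ} (β : Fin N → ℝ) (w : Fin N → Ω) :
    Fin (N + 1) → E :=
  Fin.induction (motive := fun _ => E) x₀
    fun i x => compositeProx X ψ v v' (β i) x (y x (w i))

/-- The RSMD iterates `x₀, …, x_N`: mirror descent on `X` with the proxy function
`ϑ(x) = R² θ((x - x₀)/R)`, driven by the truncated stochastic gradients. -/
noncomputable def rsmd {E : Type*} [NormedAddCommGroup E] [NormedSpace ℝ E]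
    {Ω : Type*} (X : Set E) (ψ : E → ℝ) (θ : E → ℝ) (θ' : E → StrongDual ℝ E) (x₀ : E) (R : ℝ)
    (G : E → Ω → StrongDual ℝ E) (g : StrongDual ℝ E) (xbar : E) (L lam υ σ : ℝ)
    {N : ℕ} (β : Fin N → ℝ) (w : Fin N → Ω) : Fin (N + 1) → E :=
  mirrorDescent X ψ (scaledProxy θ x₀ R) (scaledProxyGrad θ' x₀ R)
    (truncatedGrad G g xbar L lam υ σ) x₀ β w

/-- The approximate solution `[∑ β_{i-1}⁻¹]⁻¹ ∑ β_{i-1}⁻¹ x_i`, sums over `i = 1, …, N`. -/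
noncomputable def weightedAverage {E : Type*} [NormedAddCommGroup E] [NormedSpace ℝ E]
    {N : ℕ} (β : Fin N → ℝ) (x : Fin (N + 1) → E) : E :=
  (∑ i : Fin N, (β i)⁻¹)⁻¹ • ∑ i : Fin N, (β i)⁻¹ • x i.succ

/-- `ε(x^N, z) = ∑_{i=1}^N {β_{i-1}⁻¹ [⟨∇φ(x_{i-1}), x_i - z⟩ + ψ(x_i) - ψ(z)]
  + (1/2) V_{x_{i-1}}(x_i)}`. -/
noncomputable def accuracyCertificate {E : Type*} [NormedAddCommGroup E] [NormedSpace ℝ E]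
    (φ' : E → StrongDual ℝ E) (ψ : E → ℝ) (v : E → ℝ) (v' : E → StrongDual ℝ E)
    {N : ℕ} (β : Fin N → ℝ) (x : Fin (N + 1) → E) (z : E) : ℝ :=
  ∑ i : Fin N, ((β i)⁻¹ * (φ' (x i.castSucc) (x i.succ - z) + ψ (x i.succ) - ψ z)
    + (1 / 2) * bregman v v' (x i.castSucc) (x i.succ))

/-- The objective `F(x) = E{Φ(x, w)} + ψ(x)`. -/
noncomputable def objective {E Ω : Type*} [MeasurableSpace Ω] (P : Measure Ω)
    (Φ : E → Ω → ℝ) (ψ : E → ℝ) (x : E) : ℝ :=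
  ∫ w, Φ x w ∂P + ψ x

/-- The optimal value `min_{x ∈ X} F(x)`. -/
noncomputable def optimalValue {E : Type*} (F : E → ℝ) (X : Set E) : ℝ := sInf (F '' X)

/-- The smooth part of the problem: on `X`, `φ(x) = E{Φ(x, w)}` is finite, convex and differentiable
(relative to `X`, so that nothing is required of `Φ` off `X`), with gradient `φ'`, which is
`L`-Lipschitz with respect to the norm and its conjugate. -/
structure IsSmoothPart {E : Type*} [NormedAddCommGroup E] [NormedSpace ℝ E]
    {Ω : Type*} [MeasurableSpace Ω] (P : Measure Ω) (X : Set E)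
    (Φ : E → Ω → ℝ) (φ' : E → StrongDual ℝ E) (L : ℝ) : Prop where
  integrable : ∀ x ∈ X, Integrable (Φ x) P
  convexOn : ConvexOn ℝ X fun x => ∫ w, Φ x w ∂P
  hasGradient : ∀ x ∈ X, HasFDerivWithinAt (fun x => ∫ w, Φ x w ∂P) (φ' x) X x
  lipschitz : ∀ x ∈ X, ∀ x' ∈ X, ‖φ' x' - φ' x‖ ≤ L * ‖x - x'‖

/-- `G` is a stochastic oracle on `X` for the gradient `φ'`: (jointly measurable,) unbiased, with
second moment of the noise at most `σ²`. -/
structure IsStochasticOracle {E : Type*} [NormedAddCommGroup E] [NormedSpace ℝ E]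
    [MeasurableSpace E] {Ω : Type*} [MeasurableSpace Ω] (P : Measure Ω) (X : Set E)
    (φ' : E → StrongDual ℝ E) (G : E → Ω → StrongDual ℝ E) (σ : ℝ) : Prop where
  measurable : Measurable fun p : X × Ω => G p.1 p.2
  integrable : ∀ x ∈ X, Integrable (G x) P
  unbiased : ∀ x ∈ X, ∫ w, G x w ∂P = φ' x
  integrable_sq : ∀ x ∈ X, Integrable (fun w => ‖G x w - φ' x‖ ^ 2) P
  second_moment : ∀ x ∈ X, ∫ w, ‖G x w - φ' x‖ ^ 2 ∂P ≤ σ ^ 2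

/-! Write the truncated gradient as `y_i = ∇φ(x_{i-1}) + ξ_i`. The three point inequality of the
proximal step and Young's inequality bound the i-th term of the certificate by `V_{x_{i-1}}(u) -
V_{x_i}(u) + β⁻¹⟨ξ_i, u - x_{i-1}⟩ + β⁻²‖ξ_i‖²` (`primal_step`). The half of `V_{x_{i-1}}(x_i)` kept
in the certificate absorbs the curvature of `φ` because `β ≥ 2L`. Together with convexity of `F`
this makes the certificate a bound for the suboptimality of the average
(`objective_weightedAverage_sub_le`).

The term `⟨ξ_i, u - x_{i-1}⟩` must be controlled for all `u` at once. For this an auxiliary mirror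
descent `z_i`, without composite term and driven by `-ξ_i`, is run from the same point. Its own
inequality (`dual_step`) makes `⟨ξ_i, u - z_{i-1}⟩` telescope, and only `⟨ξ_i, z_{i-1} - x_{i-1}⟩ +
(3/2)β⁻¹‖ξ_i‖²` is left, where `u` no longer appears (`accuracyCertificate_le`). The telescoped part
costs twice `V_{x₀}(u) ≤ R²Θ`.

The pair `(x_i, z_i)` is a recursion driven by i.i.d. queries, so the remaining sum is estimated by
the exponential Markov inequality (`exists_event_sum_chain_le`), given an exponential moment bound
for a single increment, uniform over the states. Put `K = max(σ√(N/τ), LR)`. Truncation makes `‖ξ‖ ≤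
8K`, with bias at most `4σ²/K` and second moment at most `9σ²`. As `σ² ≤ (τ/N)K²`, an increment
divided by a quantity of order `KR + β⁻¹K²` has exponential moment at most `exp(τ/(2N))`
(`lintegral_exp_truncateAt_le`). One event of probability `1 - exp(-τ)` therefore serves all `u`. -/

open Set Filter Topology in
/-- A function whose increments dominate those of a parabola dominates it at the end point. -/
theorem add_half_le_sub_of_increments {h : ℝ → ℝ} {a b : ℝ}
    (H : ∀ s t, 0 ≤ s → s < t → t ≤ 1 → (t - s) * (a + b * s) ≤ h t - h s) :
    a + b / 2 ≤ h 1 - h 0 := by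
  -- The increments are summed over the grid `j/n`, which gives a left Riemann sum of `a + b s`. At
  -- `k = n` it falls short of `a + b/2` by `b/(2n)`. No regularity of `h` is needed.
  have key : ∀ n : ℕ, 0 < n → ∀ k : ℕ, k ≤ n →
      (k / n : ℝ) * a + b * (k * (k - 1)) / (2 * n ^ 2) ≤ h (k / n) - h 0 := by
    intro n hn k
    have hn' : (0 : ℝ) < n := by exact_mod_cast hn
    induction k with
    | zero => intro; simp
    | succ k ih =>
      intro hk
      have h1 := ih (by omega)
      have hk' : ((k : ℝ) + 1) ≤ n := by exact_mod_cast hk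
      have h2 := H (k / n) ((k + 1 : ℝ) / n) (by positivity) (by gcongr; linarith)
        ((div_le_one hn').2 hk')
      have e : (((k : ℝ) + 1) / n) * a + b * (((k : ℝ) + 1) * ((k + 1 : ℝ) - 1)) / (2 * n ^ 2)
          = (k / n : ℝ) * a + b * (k * (k - 1)) / (2 * n ^ 2)
            + ((k + 1 : ℝ) / n - k / n) * (a + b * (k / n)) := by
        field_simp
        ring
      push_cast
      rw [e]
      linarith
  have lim : Tendsto (fun n : ℕ => a + b / 2 - b / 2 * (1 / ((n : ℝ) + 1))) atTop
      (𝓝 (a + b / 2 - b / 2 * 0)) :=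
    tendsto_const_nhds.sub (tendsto_one_div_add_atTop_nhds_zero_nat.const_mul _)
  have := le_of_tendsto' (b := h 1 - h 0) lim fun n => by
    have h1 := key (n + 1) (by omega) (n + 1) le_rfl
    have hn' : (0 : ℝ) < (n : ℝ) + 1 := by positivity
    push_cast at h1
    rw [div_self hn'.ne'] at h1
    refine le_trans (le_of_eq ?_) h1
    field_simp
    ring
  simpa using this

/-! ### Existence of subgradients and rescaling of the proxy function. -/

section Subgradient

variable {E : Type*} [NormedAddCommGroup E] [NormedSpace ℝ E]

open Set in
/-- A continuous convex function has a subgradient at every interior point of its domain. -/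
theorem ConvexOn.exists_subgradient {C : Set E} {f : E → ℝ} (hf : ConvexOn ℝ C f)
    (hc : ContinuousOn f C) {x : E} (hx : x ∈ interior C) :
    ∃ s : StrongDual ℝ E, ∀ z ∈ C, f x + s (z - x) ≤ f z := by
  set U : Set (E × ℝ) := {p | p.1 ∈ interior C ∧ f p.1 < p.2}
  have hU : Convex ℝ U :=
    (hf.subset interior_subset hf.1.interior).convex_strict_epigraph
  have hUo : IsOpen U := by
    have h1 : IsOpen ((interior C) ×ˢ (univ : Set ℝ)) := isOpen_interior.prod isOpen_univ
    have h2 : ContinuousOn (fun p : E × ℝ => p.2 - f p.1) ((interior C) ×ˢ (univ : Set ℝ)) :=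
      continuousOn_snd.sub ((hc.mono interior_subset).comp continuousOn_fst fun p hp => hp.1)
    have h3 := h2.isOpen_inter_preimage h1 (isOpen_Ioi (a := (0 : ℝ)))
    convert h3 using 1
    ext p
    simp [U]
  obtain ⟨F, hF⟩ := geometric_hahn_banach_open_point hU hUo
    (show (x, f x) ∉ U from fun h => lt_irrefl _ h.2)
  have split : ∀ y t, F (y, t) = F (y, 0) + t * F (0, 1) := fun y t => by
    have : ((y, t) : E × ℝ) = (y, 0) + t • (0, 1) := by simp
    rw [this, map_add, map_smul, smul_eq_mul]
  -- Because `x` is interior, the point straight above `(x, f x)` lies in the separated set. Hence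
  -- the hyperplane is not vertical and can be solved for the last coordinate.
  have hα : F (0, 1) < 0 := by
    have := hF (x, f x + 1) ⟨hx, by simp⟩
    rw [split, split x (f x)] at this
    linarith
  set α := -F (0, 1) with hαdef
  have hα0 : 0 < α := by linarith
  set s : StrongDual ℝ E := α⁻¹ • F.comp (ContinuousLinearMap.inl ℝ E ℝ) with hs
  have hsx : ∀ y, s y = α⁻¹ * F (y, 0) := fun y => by simp [hs]
  have int : ∀ y ∈ interior C, f x + s (y - x) ≤ f y := by
    intro y hy
    refine le_of_forall_gt_imp_ge_of_dense fun t ht => ?_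
    have := hF (y, t) ⟨hy, ht⟩
    rw [split, split x (f x)] at this
    rw [map_sub, hsx, hsx, ← mul_sub, ← sub_nonneg]
    have e : t - (f x + α⁻¹ * (F (y, 0) - F (x, 0)))
        = α⁻¹ * (α * (t - f x) - (F (y, 0) - F (x, 0))) := by field_simp; ring
    rw [e]
    refine mul_nonneg (inv_nonneg.2 hα0.le) ?_
    rw [hαdef]; linarith
  refine ⟨s, fun z hz => ?_⟩
  -- The midpoint of an interior point and any `z` in `C` is interior. Convexity along the segment
  -- then carries the inequality on to `z`.
  have hm : (1 / 2 : ℝ) • x + (1 / 2 : ℝ) • z ∈ interior C :=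
    hf.1.combo_interior_self_mem_interior hx hz (by norm_num) (by norm_num) (by norm_num)
  have h1 := int _ hm
  have h2 := hf.2 (interior_subset hx) hz (by norm_num : (0 : ℝ) ≤ 1 / 2)
    (by norm_num : (0 : ℝ) ≤ 1 / 2) (by norm_num)
  have e : (1 / 2 : ℝ) • x + (1 / 2 : ℝ) • z - x = (1 / 2 : ℝ) • (z - x) := by module
  rw [e, map_smul] at h1
  simp only [smul_eq_mul] at h1 h2
  linarith

/-- The points of `B` at which `v` has a subgradient relative to `B`. -/
def subgradientDomain (B : Set E) (v : E → ℝ) : Set E :=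
  {x | x ∈ B ∧ ∃ s : StrongDual ℝ E, ∀ z ∈ B, v x + s (z - x) ≤ v z}

/-- `v` is a proxy function on the ball of center `c` and radius `r`, with a continuous selection
`v'` of subgradients. -/
structure IsBallProxy (c : E) (r : ℝ) (v : E → ℝ) (v' : E → StrongDual ℝ E) : Prop where
  pos : 0 < r
  convexOn : ConvexOn ℝ (Metric.closedBall c r) v
  continuousOn : ContinuousOn v (Metric.closedBall c r)
  subgradient : ∀ x ∈ subgradientDomain (Metric.closedBall c r) v, ∀ z ∈ Metric.closedBall c r,
    v x + v' x (z - x) ≤ v z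
  continuousOn_grad : ContinuousOn v' (subgradientDomain (Metric.closedBall c r) v)
  strongly_monotone : ∀ x ∈ subgradientDomain (Metric.closedBall c r) v,
    ∀ z ∈ subgradientDomain (Metric.closedBall c r) v, ‖x - z‖ ^ 2 ≤ (v' x - v' z) (x - z)
  isMinOn : IsMinOn v (Metric.closedBall c r) c

-- Under the homothety `x ↦ (x - c)/r`, the factor `r²` of the function and `r` of the gradient keep
-- the modulus of strong monotonicity equal to 1 in the same norm.
open Metric in
theorem IsNormalizedProxy.isBallProxy {θ : E → ℝ} {θ' : E → StrongDual ℝ E}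
    (h : IsNormalizedProxy θ θ') (c : E) {r : ℝ} (hr : 0 < r) :
    IsBallProxy c r (scaledProxy θ c r) (scaledProxyGrad θ' c r) := by
  have maps : ∀ {x : E}, x ∈ closedBall c r ↔ r⁻¹ • (x - c) ∈ closedBall (0 : E) 1 := by
    intro x
    rw [mem_closedBall, mem_closedBall, dist_zero_right, dist_eq_norm, norm_smul, norm_inv,
      Real.norm_of_nonneg hr.le, inv_mul_le_iff₀ hr, mul_one]
  have dom : ∀ {x : E}, x ∈ subgradientDomain (closedBall c r) (scaledProxy θ c r) →
      r⁻¹ • (x - c) ∈ ballSubdiffDomain θ := by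
    rintro x ⟨hx, s, hs⟩
    refine ⟨maps.1 hx, r⁻¹ • s, fun z hz => ?_⟩
    have e : r⁻¹ • (c + r • z - c) = z := by
      rw [add_sub_cancel_left, smul_smul, inv_mul_cancel₀ hr.ne', one_smul]
    have h1 := hs (c + r • z) (maps.2 (by rwa [e]))
    unfold scaledProxy at h1
    rw [e] at h1
    have e2 : c + r • z - x = r • (z - r⁻¹ • (x - c)) := by
      rw [smul_sub, smul_smul, mul_inv_cancel₀ hr.ne', one_smul]; abel
    rw [e2, map_smul, smul_eq_mul] at h1
    rw [smul_apply, smul_eq_mul, ← sub_nonneg]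
    have e3 : θ z - (θ (r⁻¹ • (x - c)) + r⁻¹ * s (z - r⁻¹ • (x - c)))
       = (r ^ 2)⁻¹ * (r ^ 2 * θ z - (r ^ 2 * θ (r⁻¹ • (x - c)) + r * s (z - r⁻¹ • (x - c)))) := by
      field_simp
    rw [e3]
    exact mul_nonneg (by positivity) (by linarith)
  have cont : Continuous fun x : E => r⁻¹ • (x - c) := by fun_prop
  refine ⟨hr, ?_, ?_, ?_, ?_, ?_, ?_⟩
  · refine ⟨convex_closedBall _ _, fun x hx y hy a b ha hb hab => ?_⟩
    have := h.convexOn.2 (maps.1 hx) (maps.1 hy) ha hb hab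
    have e : r⁻¹ • (a • x + b • y - c) = a • r⁻¹ • (x - c) + b • r⁻¹ • (y - c) := by
      have : c = (a + b) • c := by rw [hab, one_smul]
      nth_rewrite 1 [this]
      module
    simp only [scaledProxy, smul_eq_mul] at this ⊢
    rw [e]
    nlinarith [sq_nonneg r]
  · exact continuousOn_const.mul (h.continuousOn.comp cont.continuousOn fun x hx => maps.1 hx)
  · intro x hx z hz
    have := h.subgradient _ (dom hx) _ (maps.1 hz)
    have e : r⁻¹ • (z - c) - r⁻¹ • (x - c) = r⁻¹ • (z - x) := by module
    rw [e, map_smul, smul_eq_mul] at this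
    simp only [scaledProxy, scaledProxyGrad, smul_apply, smul_eq_mul]
    have h2 := mul_le_mul_of_nonneg_left this (sq_nonneg r)
    have e3 : r ^ 2 * (θ (r⁻¹ • (x - c)) + r⁻¹ * θ' (r⁻¹ • (x - c)) (z - x))
       = r ^ 2 * θ (r⁻¹ • (x - c)) + r * θ' (r⁻¹ • (x - c)) (z - x) := by
      field_simp
    linarith
  · exact (h.continuousOn_subgradient.comp cont.continuousOn fun x hx => dom hx).const_smul r
  · intro x hx z hz
    have := h.strongly_monotone _ (dom hx) _ (dom hz)
    have e : r⁻¹ • (x - c) - r⁻¹ • (z - c) = r⁻¹ • (x - z) := by module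
    rw [e, map_smul, smul_eq_mul, norm_smul, norm_inv, Real.norm_of_nonneg hr.le] at this
    have e4 : (scaledProxyGrad θ' c r x - scaledProxyGrad θ' c r z) (x - z)
        = r * (θ' (r⁻¹ • (x - c)) - θ' (r⁻¹ • (z - c))) (x - z) := by
      simp only [scaledProxyGrad, sub_apply, smul_apply, smul_eq_mul, mul_sub]
    rw [e4]
    have h2 := mul_le_mul_of_nonneg_left this (sq_nonneg r)
    have e3 : r ^ 2 * (r⁻¹ * ‖x - z‖) ^ 2 = ‖x - z‖ ^ 2 := by field_simp
    rw [e3] at h2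
    refine h2.trans (le_of_eq ?_)
    field_simp
  · intro x hx
    have := h.isMinOn_zero (maps.1 hx)
    simp only [Set.mem_ofPred_eq, scaledProxy, sub_self, smul_zero] at this ⊢
    gcongr

end Subgradient

/-! ### Quadratic growth and first order optimality for a proxy function. -/

namespace IsBallProxy

open Metric Filter Topology Set

variable {E : Type*} [NormedAddCommGroup E] [NormedSpace ℝ E] {c : E} {r : ℝ} {v : E → ℝ}
  {v' : E → StrongDual ℝ E}

theorem tendsto_strongDual_apply {ι : Type*} {l : Filter ι} {f : ι → StrongDual ℝ E} {x : ι → E}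
    {g : StrongDual ℝ E} {y : E} (hf : Tendsto f l (𝓝 g)) (hx : Tendsto x l (𝓝 y)) :
    Tendsto (fun i => f i (x i)) l (𝓝 (g y)) :=
  (isBoundedBilinearMap_apply.continuous.tendsto (g, y)).comp (hf.prodMk_nhds hx)

theorem ball_subset (h : IsBallProxy c r v v') :
    ball c r ⊆ subgradientDomain (closedBall c r) v := fun _ hx =>
  ⟨ball_subset_closedBall hx,
    h.convexOn.exists_subgradient h.continuousOn (ball_subset_interior_closedBall hx)⟩

theorem center_mem (h : IsBallProxy c r v v') : c ∈ subgradientDomain (closedBall c r) v :=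
  h.ball_subset (mem_ball_self h.pos)

/-- Moving a point of the closed ball towards a point of the open ball leads into the open ball. -/
theorem add_smul_sub_mem_ball {x u : E} (hx : x ∈ closedBall c r) (hu : u ∈ ball c r) {t : ℝ}
    (ht : 0 < t) (ht1 : t ≤ 1) : x + t • (u - x) ∈ ball c r := by
  have e : x + t • (u - x) - c = (1 - t) • (x - c) + t • (u - c) := by module
  rw [mem_closedBall, dist_eq_norm] at hx
  rw [mem_ball, dist_eq_norm] at hu ⊢
  rw [e]
  calc _ ≤ ‖(1 - t) • (x - c)‖ + ‖t • (u - c)‖ := norm_add_le _ _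
    _ = (1 - t) * ‖x - c‖ + t * ‖u - c‖ := by
      rw [norm_smul, norm_smul, Real.norm_of_nonneg ht.le, Real.norm_of_nonneg (by linarith)]
    _ < r := by nlinarith

theorem tendsto_add_smul (x d : E) :
    Tendsto (fun t : ℝ => x + t • d) (𝓝[>] 0) (𝓝 x) := by
  have : Continuous fun t : ℝ => x + t • d := by fun_prop
  have h := this.tendsto 0
  simp only [zero_smul, add_zero] at h
  exact h.mono_left nhdsWithin_le_nhds

theorem eventually_mem_Ioc : ∀ᶠ t : ℝ in 𝓝[>] 0, 0 < t ∧ t ≤ 1 :=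
  Ioc_mem_nhdsGT (zero_lt_one)

/-- The Bregman divergence dominates half of the squared distance. -/
theorem half_sq_le_bregman (h : IsBallProxy c r v v') {x z : E}
    (hx : x ∈ subgradientDomain (closedBall c r) v) (hz : z ∈ closedBall c r) :
    ‖z - x‖ ^ 2 / 2 ≤ bregman v v' x z := by
  -- For `z` in the open ball the whole segment from `x` lies in the domain of `v'`. Strong
  -- monotonicity makes the slope at parameter `s` exceed the slope at `0` by at least `s‖z - x‖²`.
  -- The sphere is reached by continuity of `v`.
  have int : ∀ z ∈ ball c r, ‖z - x‖ ^ 2 / 2 ≤ bregman v v' x z := by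
    intro z hz
    have mem : ∀ t : ℝ, 0 ≤ t → t ≤ 1 →
        x + t • (z - x) ∈ subgradientDomain (closedBall c r) v := by
      intro t ht ht1
      rcases ht.eq_or_lt with rfl | ht
      · simpa using hx
      · exact h.ball_subset (add_smul_sub_mem_ball hx.1 hz ht ht1)
    have key := add_half_le_sub_of_increments (h := fun t : ℝ => v (x + t • (z - x)))
      (a := v' x (z - x)) (b := ‖z - x‖ ^ 2) (fun s t hs hst ht => by
        have h1 := h.subgradient _ (mem s hs (hst.le.trans ht)) _ (mem t (hs.trans hst.le) ht).1
        have e1 : x + t • (z - x) - (x + s • (z - x)) = (t - s) • (z - x) := by module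
        rw [e1, map_smul, smul_eq_mul] at h1
        have h2 : v' x (z - x) + ‖z - x‖ ^ 2 * s ≤ v' (x + s • (z - x)) (z - x) := by
          rcases hs.eq_or_lt with rfl | hs
          · simp
          · have h3 := h.strongly_monotone _ (mem s hs.le (hst.le.trans ht)) _ hx
            rw [add_sub_cancel_left, map_smul, norm_smul, Real.norm_of_nonneg hs.le, smul_eq_mul,
              sub_apply] at h3
            have : s * (‖z - x‖ ^ 2 * s) ≤ s * (v' (x + s • (z - x)) (z - x) - v' x (z - x)) := by
              nlinarith
            linarith [le_of_mul_le_mul_left this hs]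
        have h4 := mul_le_mul_of_nonneg_left h2 (sub_pos.2 hst).le
        linarith)
    simp only [one_smul, zero_smul, add_zero, add_sub_cancel] at key
    unfold bregman
    linarith
  have hcl : closure (ball c r) = closedBall c r := closure_ball c h.pos.ne'
  refine le_on_closure (s := ball c r) (f := fun z => ‖z - x‖ ^ 2 / 2) (g := bregman v v' x)
    int (by fun_prop) ?_ (by rwa [hcl])
  rw [hcl]
  unfold bregman
  exact (h.continuousOn.sub continuousOn_const).sub (by fun_prop)

/-- Zero is a subgradient at the minimizer `c`, but a selection could pick another one. Subgradients
at `c + t • d` are nonnegative on `d` since `v` is minimal at `c`, and continuity of the selection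
passes this to `c`. Applied to `d` and `-d`, it forces the value zero. -/
theorem grad_center (h : IsBallProxy c r v v') : v' c = 0 := by
  have nonneg : ∀ d : E, 0 ≤ v' c d := by
    intro d
    have ht := tendsto_add_smul c d
    have hball : ∀ᶠ t : ℝ in 𝓝[>] 0, c + t • d ∈ ball c r :=
      ht.eventually (ball_mem_nhds c h.pos)
    have h1 : Tendsto (fun t : ℝ => v' (c + t • d)) (𝓝[>] 0) (𝓝 (v' c)) :=
      (h.continuousOn_grad c h.center_mem).tendsto.comp
        (tendsto_nhdsWithin_iff.2 ⟨ht, hball.mono fun t ht => h.ball_subset ht⟩)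
    have h2 : Tendsto (fun t : ℝ => v' (c + t • d) d) (𝓝[>] 0) (𝓝 (v' c d)) :=
      tendsto_strongDual_apply h1 tendsto_const_nhds
    refine ge_of_tendsto h2 ?_
    filter_upwards [hball, self_mem_nhdsWithin] with t hb (ht0 : 0 < t)
    have h3 := h.subgradient _ (h.ball_subset hb) _ h.center_mem.1
    have h4 : v c ≤ v (c + t • d) := h.isMinOn (ball_subset_closedBall hb)
    have e : c - (c + t • d) = (-t) • d := by module
    rw [e, map_smul, smul_eq_mul] at h3
    by_contra hneg
    nlinarith
  ext d
  have := nonneg (-d)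
  rw [map_neg] at this
  exact le_antisymm (by simpa using this) (nonneg d)

/-- Directional optimality of a minimizer, expressed at nearby interior points. -/
theorem variational_near (h : IsBallProxy c r v v') {X : Set E} (hXc : Convex ℝ X)
    (hXB : X ⊆ closedBall c r) {ψ : E → ℝ} (hψ : ConvexOn ℝ X ψ) {β : ℝ} (hβ : 0 < β)
    {η : StrongDual ℝ E} {z : E} (hz : z ∈ X)
    (hmin : IsMinOn (fun u => η u + ψ u + β * v u) X z) {u : E} (hu : u ∈ X)
    (hub : u ∈ ball c r) {t : ℝ} (ht : 0 < t) (ht1 : t ≤ 1) :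
    0 ≤ η (u - z) + β * v' (z + t • (u - z)) (u - z) + ψ u - ψ z := by
  have hb := add_smul_sub_mem_ball (hXB hz) hub ht ht1
  have e : z + t • (u - z) = (1 - t) • z + t • u := by module
  have hX : z + t • (u - z) ∈ X := by
    rw [e]; exact hXc hz hu (by linarith) ht.le (by ring)
  have h1 : η z + ψ z + β * v z ≤ _ := hmin hX
  have h2 := h.subgradient _ (h.ball_subset hb) _ (hXB hz)
  have h3 : ψ (z + t • (u - z)) ≤ (1 - t) * ψ z + t * ψ u := by
    rw [e]; exact hψ.2 hz hu (by linarith) ht.le (by ring)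
  have e2 : z - (z + t • (u - z)) = (-t) • (u - z) := by module
  rw [e2, map_smul, smul_eq_mul] at h2
  simp only [map_add, map_smul, smul_eq_mul] at h1
  have h4 := mul_le_mul_of_nonneg_left h2 hβ.le
  by_contra hneg
  push Not at hneg
  have := mul_neg_of_pos_of_neg ht hneg
  nlinarith

variable [FiniteDimensional ℝ E]

/-- A minimizer of a composite function with the proxy `v` has a subgradient of `v`. -/
theorem minimizer_mem (h : IsBallProxy c r v v') {X : Set E} (hXc : Convex ℝ X)
    (hXB : X ⊆ closedBall c r) (hc : c ∈ X) {ψ : E → ℝ} (hψ : ConvexOn ℝ X ψ) {β : ℝ} (hβ : 0 < β)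
    {η : StrongDual ℝ E} {z : E} (hz : z ∈ X)
    (hmin : IsMinOn (fun u => η u + ψ u + β * v u) X z) :
    z ∈ subgradientDomain (closedBall c r) v := by
  have : ProperSpace E := FiniteDimensional.proper_real E
  have : ProperSpace (StrongDual ℝ E) := FiniteDimensional.proper_real _
  obtain ⟨m, hm⟩ := (isCompact_closedBall c r).bddAbove_image h.continuousOn
  have hm : ∀ y ∈ closedBall c r, v y ≤ m := fun y hy => hm (mem_image_of_mem v hy)
  set t : ℕ → ℝ := fun n => 1 / ((n : ℝ) + 1)
  have ht0 : ∀ n, 0 < t n := fun n => by positivity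
  have ht1 : ∀ n, t n ≤ 1 := fun n => by
    rw [div_le_one (by positivity)]
    linarith [(Nat.cast_nonneg n : (0 : ℝ) ≤ n)]
  have htt : Tendsto t atTop (𝓝[>] 0) := tendsto_nhdsWithin_iff.2
    ⟨tendsto_one_div_add_atTop_nhds_zero_nat, Eventually.of_forall ht0⟩
  set w : ℕ → E := fun n => z + t n • (c - z) with hw
  have hwb : ∀ n, w n ∈ ball c r := fun n =>
    add_smul_sub_mem_ball (hXB hz) (mem_ball_self h.pos) (ht0 n) (ht1 n)
  have hwz : Tendsto w atTop (𝓝 z) := (tendsto_add_smul z (c - z)).comp htt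
  -- A minimizer on the sphere might have no subgradient, so it is approached from the inside.
  -- Optimality bounds the subgradients at `w n` from above along `z - c`. The absolute value makes
  -- `K` nonnegative, so that the factor `1 - t n` can be dropped later.
  set K : ℝ := |β⁻¹ * (η (c - z) + ψ c - ψ z)|
  have hK : ∀ n, v' (w n) (z - c) ≤ K := by
    intro n
    have h1 := h.variational_near hXc hXB hψ hβ hz hmin hc (mem_ball_self h.pos) (ht0 n) (ht1 n)
    have e : v' (w n) (c - z) = -v' (w n) (z - c) := by rw [← map_neg, neg_sub]
    change 0 ≤ η (c - z) + β * v' (w n) (c - z) + ψ c - ψ z at h1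
    rw [e] at h1
    refine le_trans ?_ (le_abs_self _)
    rw [le_inv_mul_iff₀ hβ]
    linarith
  -- Testing the subgradient inequality on the whole ball turns the one-sided bound into a norm
  -- bound. By compactness a subsequence converges, and its limit is a subgradient at `z`.
  have hbound : ∀ n, ‖v' (w n)‖ ≤ (m - v c + K) / r := by
    intro n
    have up : ∀ d ∈ closedBall (0 : E) r, v' (w n) d ≤ m - v c + K := by
      intro d hd
      have hd' : c + d ∈ closedBall c r := by simpa [dist_eq_norm] using hd
      have h1 := h.subgradient _ (h.ball_subset (hwb n)) _ hd'
      have h2 := hm _ hd'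
      have h3 : v c ≤ v (w n) := h.isMinOn (ball_subset_closedBall (hwb n))
      have e : c + d - w n = d + (-(1 - t n)) • (z - c) := by simp only [hw]; module
      rw [e, map_add, map_smul, smul_eq_mul] at h1
      have h4 : (1 - t n) * v' (w n) (z - c) ≤ K := by
        have : (1 - t n) * v' (w n) (z - c) ≤ (1 - t n) * K :=
          mul_le_mul_of_nonneg_left (hK n) (by linarith [ht1 n])
        nlinarith [ht0 n, abs_nonneg (β⁻¹ * (η (c - z) + ψ c - ψ z))]
      linarith
    refine ContinuousLinearMap.opNorm_bound_of_ball_bound h.pos _ _ fun d hd => ?_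
    rw [Real.norm_eq_abs, abs_le']
    refine ⟨up d hd, ?_⟩
    have := up (-d) (by simpa using hd)
    rwa [map_neg] at this
  obtain ⟨s, -, k, hk, hs⟩ := tendsto_subseq_of_bounded
    (isBounded_closedBall (x := (0 : StrongDual ℝ E)) (r := (m - v c + K) / r))
    (x := fun n => v' (w n)) (fun n => by simpa using hbound n)
  refine ⟨hXB hz, s, fun y hy => ?_⟩
  have hwk : Tendsto (fun n => w (k n)) atTop (𝓝 z) := hwz.comp hk.tendsto_atTop
  have l1 : Tendsto (fun n => v (w (k n))) atTop (𝓝 (v z)) :=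
    (h.continuousOn z (hXB hz)).tendsto.comp (tendsto_nhdsWithin_iff.2
      ⟨hwk, Eventually.of_forall fun n => ball_subset_closedBall (hwb _)⟩)
  have l2 : Tendsto (fun n => v' (w (k n)) (y - w (k n))) atTop (𝓝 (s (y - z))) :=
    tendsto_strongDual_apply hs (tendsto_const_nhds.sub hwk)
  exact le_of_tendsto' (l1.add l2) fun n => h.subgradient _ (h.ball_subset (hwb _)) _ hy

/-- First order optimality condition for a minimizer of a composite function with the proxy `v`. -/
theorem variational (h : IsBallProxy c r v v') {X : Set E} (hXc : Convex ℝ X)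
    (hXB : X ⊆ closedBall c r) (hc : c ∈ X) {ψ : E → ℝ} (hψ : ConvexOn ℝ X ψ)
    (hψc : ContinuousOn ψ X) {β : ℝ} (hβ : 0 < β)
    {η : StrongDual ℝ E} {z : E} (hz : z ∈ X)
    (hmin : IsMinOn (fun u => η u + ψ u + β * v u) X z) {u : E} (hu : u ∈ X) :
    0 ≤ η (u - z) + β * v' z (u - z) + ψ u - ψ z := by
  have hzD := h.minimizer_mem hXc hXB hc hψ hβ hz hmin
  have int : ∀ u ∈ X, u ∈ ball c r → 0 ≤ η (u - z) + β * v' z (u - z) + ψ u - ψ z := by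
    intro u hu hub
    have h1 : Tendsto (fun t : ℝ => v' (z + t • (u - z))) (𝓝[>] 0) (𝓝 (v' z)) :=
      (h.continuousOn_grad z hzD).tendsto.comp (tendsto_nhdsWithin_iff.2
        ⟨tendsto_add_smul z (u - z), eventually_mem_Ioc.mono fun t ht =>
          h.ball_subset (add_smul_sub_mem_ball (hXB hz) hub ht.1 ht.2)⟩)
    have h2 : Tendsto (fun t : ℝ => η (u - z) + β * v' (z + t • (u - z)) (u - z) + ψ u - ψ z)
        (𝓝[>] 0) (𝓝 (η (u - z) + β * v' z (u - z) + ψ u - ψ z)) :=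
      (((tendsto_strongDual_apply h1 tendsto_const_nhds).const_mul β).const_add _).add_const _ |>.sub_const _
    exact ge_of_tendsto h2 (eventually_mem_Ioc.mono fun t ht =>
      h.variational_near hXc hXB hψ hβ hz hmin hu hub ht.1 ht.2)
  -- A point `u` on the sphere is a limit of points of `X` in the open ball, because `c` is in `X`.
  have hlim := tendsto_add_smul u (c - u)
  have hX : ∀ᶠ t : ℝ in 𝓝[>] 0, u + t • (c - u) ∈ X :=
    eventually_mem_Ioc.mono fun t ht => by
      have e : u + t • (c - u) = (1 - t) • u + t • c := by module
      rw [e]; exact hXc hu hc (by linarith [ht.2]) ht.1.le (by ring)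
  have l1 : Tendsto (fun t : ℝ => ψ (u + t • (c - u))) (𝓝[>] 0) (𝓝 (ψ u)) :=
    (hψc u hu).tendsto.comp (tendsto_nhdsWithin_iff.2 ⟨hlim, hX⟩)
  have l2 : ∀ f : StrongDual ℝ E,
      Tendsto (fun t : ℝ => f (u + t • (c - u) - z)) (𝓝[>] 0) (𝓝 (f (u - z))) := fun f =>
    (f.continuous.tendsto _).comp (hlim.sub_const z)
  refine ge_of_tendsto ((((l2 η).add ((l2 (v' z)).const_mul β)).add l1).sub_const (ψ z)) ?_
  filter_upwards [hX, eventually_mem_Ioc] with t htX ht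
  exact int _ htX (add_smul_sub_mem_ball (hXB hu) (mem_ball_self h.pos) ht.1 ht.2)

end IsBallProxy

/-! ### The composite proximal step. -/

section Prox

open Metric

variable {E : Type*} [NormedAddCommGroup E] [NormedSpace ℝ E]

/-- A minimizer of `η + ψ + β v` over `X`. -/
noncomputable def proxMap (X : Set E) (ψ v : E → ℝ) (β : ℝ) (η : StrongDual ℝ E) : E :=
  Classical.epsilon fun z => z ∈ X ∧ IsMinOn (fun u => η u + ψ u + β * v u) X z

/-- The two objectives differ by a constant, so they have the same minimizers and the same choice is
made. The step thus depends on `x` and `ξ` through a single dual vector, which reduces its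
measurability to continuity of `proxMap`. -/
theorem compositeProx_eq_proxMap (X : Set E) (ψ v : E → ℝ) (v' : E → StrongDual ℝ E) (β : ℝ)
    (x : E) (ξ : StrongDual ℝ E) :
    compositeProx X ψ v v' β x ξ = proxMap X ψ v β (ξ - β • v' x) := by
  unfold compositeProx proxMap
  congr 1
  funext z
  have e : ∀ u : E, ξ u + ψ u + β * bregman v v' x u
      = ((ξ - β • v' x) u + ψ u + β * v u) + β * (v' x x - v x) := by
    intro u
    simp only [bregman, map_sub, sub_apply, smul_apply, smul_eq_mul]
    ring
  simp only [isMinOn_iff, e, add_le_add_iff_right]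

/-- The data of a composite proximal step over a compact convex subset of the ball of a proxy
function, containing the center of the ball. -/
structure IsProxProblem (c : E) (r : ℝ) (v : E → ℝ) (v' : E → StrongDual ℝ E) (X : Set E)
    (ψ : E → ℝ) : Prop where
  proxy : IsBallProxy c r v v'
  isCompact : IsCompact X
  subset : X ⊆ closedBall c r
  center_mem : c ∈ X
  convexOn : ConvexOn ℝ X ψ
  continuousOn : ContinuousOn ψ X

namespace IsProxProblem

variable {c : E} {r : ℝ} {v : E → ℝ} {v' : E → StrongDual ℝ E} {X : Set E} {ψ : E → ℝ}

theorem proxMap_spec (h : IsProxProblem c r v v' X ψ) (β : ℝ) (η : StrongDual ℝ E) :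
    proxMap X ψ v β η ∈ X ∧
      IsMinOn (fun u => η u + ψ u + β * v u) X (proxMap X ψ v β η) :=
  Classical.epsilon_spec (p := fun z => z ∈ X ∧ IsMinOn (fun u => η u + ψ u + β * v u) X z) <|
    h.isCompact.exists_isMinOn ⟨c, h.center_mem⟩
      ((η.continuous.continuousOn.add h.continuousOn).add
        (continuousOn_const.mul (h.proxy.continuousOn.mono h.subset)))

variable [FiniteDimensional ℝ E]

theorem proxMap_mem (h : IsProxProblem c r v v' X ψ) {β : ℝ} (hβ : 0 < β) (η : StrongDual ℝ E) :
    proxMap X ψ v β η ∈ X ∩ subgradientDomain (closedBall c r) v :=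
  ⟨(h.proxMap_spec β η).1, h.proxy.minimizer_mem h.convexOn.1 h.subset h.center_mem h.convexOn hβ
    (h.proxMap_spec β η).1 (h.proxMap_spec β η).2⟩

theorem proxMap_variational (h : IsProxProblem c r v v' X ψ) {β : ℝ} (hβ : 0 < β)
    (η : StrongDual ℝ E) {u : E} (hu : u ∈ X) :
    0 ≤ η (u - proxMap X ψ v β η) + β * v' (proxMap X ψ v β η) (u - proxMap X ψ v β η)
      + ψ u - ψ (proxMap X ψ v β η) :=
  h.proxy.variational h.convexOn.1 h.subset h.center_mem h.convexOn h.continuousOn hβ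
    (h.proxMap_spec β η).1 (h.proxMap_spec β η).2 hu

/-- Each optimality condition is tested at the other minimizer. Their sum, with strong monotonicity
of `v'`, leaves `β‖x - y‖² ≤ ‖η - ζ‖ ‖x - y‖`. -/
theorem norm_proxMap_sub_le (h : IsProxProblem c r v v' X ψ) {β : ℝ} (hβ : 0 < β)
    (η ζ : StrongDual ℝ E) :
    ‖proxMap X ψ v β η - proxMap X ψ v β ζ‖ ≤ β⁻¹ * ‖η - ζ‖ := by
  have h1 := h.proxMap_variational hβ η (h.proxMap_spec β ζ).1
  have h2 := h.proxMap_variational hβ ζ (h.proxMap_spec β η).1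
  have h3 := h.proxy.strongly_monotone _ (h.proxMap_mem hβ η).2 _ (h.proxMap_mem hβ ζ).2
  set x := proxMap X ψ v β η
  set y := proxMap X ψ v β ζ
  have e : ∀ f : StrongDual ℝ E, f (y - x) = -f (x - y) := fun f => by rw [← map_neg, neg_sub]
  rw [e η, e (v' x)] at h1
  rw [sub_apply] at h3
  have h4 : -(η - ζ) (x - y) ≤ ‖η - ζ‖ * ‖x - y‖ :=
    (neg_le_abs _).trans ((η - ζ).le_opNorm (x - y))
  rw [sub_apply] at h4
  have h5 : β * ‖x - y‖ ^ 2 ≤ ‖η - ζ‖ * ‖x - y‖ := by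
    have := mul_le_mul_of_nonneg_left h3 hβ.le
    linarith
  rw [le_inv_mul_iff₀ hβ]
  rcases (norm_nonneg (x - y)).eq_or_lt with h0 | h0
  · rw [← h0, mul_zero]; exact norm_nonneg _
  · exact le_of_mul_le_mul_right (by linarith) h0

theorem continuous_proxMap (h : IsProxProblem c r v v' X ψ) {β : ℝ} (hβ : 0 < β) :
    Continuous (proxMap X ψ v β) :=
  (LipschitzWith.of_dist_le_mul (K := (β⁻¹).toNNReal) fun η ζ => by
    rw [dist_eq_norm, dist_eq_norm, Real.coe_toNNReal _ (inv_nonneg.2 hβ.le)]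
    exact h.norm_proxMap_sub_le hβ η ζ).continuous

theorem compositeProx_mem (h : IsProxProblem c r v v' X ψ) {β : ℝ} (hβ : 0 < β) (x : E)
    (ξ : StrongDual ℝ E) :
    compositeProx X ψ v v' β x ξ ∈ X ∩ subgradientDomain (closedBall c r) v := by
  rw [compositeProx_eq_proxMap]
  exact h.proxMap_mem hβ _

/-- The three point inequality of the proximal step. -/
theorem compositeProx_three_point (h : IsProxProblem c r v v' X ψ) {β : ℝ} (hβ : 0 < β) (x : E)
    (ξ : StrongDual ℝ E) {u : E} (hu : u ∈ X) :
    ξ (compositeProx X ψ v v' β x ξ - u) + ψ (compositeProx X ψ v v' β x ξ) - ψ u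
      ≤ β * (bregman v v' x u - bregman v v' (compositeProx X ψ v v' β x ξ) u
        - bregman v v' x (compositeProx X ψ v v' β x ξ)) := by
  have h1 := h.proxMap_variational hβ (ξ - β • v' x) hu
  rw [← compositeProx_eq_proxMap] at h1
  simp only [bregman, map_sub, sub_apply, smul_apply, smul_eq_mul] at h1 ⊢
  linarith

/-- One mirror descent step along an inexact gradient `f + ξ`. -/
theorem primal_step (h : IsProxProblem c r v v' X ψ) {β : ℝ} (hβ : 0 < β) {x : E}
    (hx : x ∈ subgradientDomain (closedBall c r) v) (f ξ : StrongDual ℝ E) {u : E} (hu : u ∈ X) :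
    β⁻¹ * (f (compositeProx X ψ v v' β x (f + ξ) - u) + ψ (compositeProx X ψ v v' β x (f + ξ)) - ψ u)
        + 1 / 2 * bregman v v' x (compositeProx X ψ v v' β x (f + ξ))
      ≤ bregman v v' x u - bregman v v' (compositeProx X ψ v v' β x (f + ξ)) u
        + β⁻¹ * ξ (u - x) + β⁻¹ * (β⁻¹ * ‖ξ‖ ^ 2) := by
  have h1 := h.compositeProx_three_point hβ x (f + ξ) hu
  have h2 := h.proxy.half_sq_le_bregman hx (h.subset (h.compositeProx_mem hβ x (f + ξ)).1)
  set y := compositeProx X ψ v v' β x (f + ξ)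
  have h3 : -ξ (y - x) ≤ ‖ξ‖ * ‖y - x‖ := (neg_le_abs _).trans (ξ.le_opNorm (y - x))
  -- One half of the divergence stays in the certificate. The other half is at least `‖y - x‖²/4`
  -- and pays for Young's inequality.
  have h4 : ‖ξ‖ * ‖y - x‖ ≤ β⁻¹ * ‖ξ‖ ^ 2 + β * ‖y - x‖ ^ 2 / 4 := by
    have : β⁻¹ * ‖ξ‖ ^ 2 + β * ‖y - x‖ ^ 2 / 4 - ‖ξ‖ * ‖y - x‖
        = β⁻¹ * (‖ξ‖ - β * ‖y - x‖ / 2) ^ 2 := by field_simp; ring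
    have h5 : 0 ≤ β⁻¹ * (‖ξ‖ - β * ‖y - x‖ / 2) ^ 2 := by positivity
    linarith
  have h5 := mul_le_mul_of_nonneg_left h2 hβ.le
  have e : (f + ξ) (y - u) = f (y - u) + ξ (y - x) - ξ (u - x) := by
    simp only [map_sub, add_apply]; ring
  rw [e] at h1
  have h6 := mul_le_mul_of_nonneg_left
    (show f (y - u) + ψ y - ψ u ≤ β * (bregman v v' x u - bregman v v' y u
      - 1 / 2 * bregman v v' x y) + ξ (u - x) + β⁻¹ * ‖ξ‖ ^ 2 by linarith) (inv_nonneg.2 hβ.le)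
  rw [mul_add, mul_add, inv_mul_cancel_left₀ hβ.ne'] at h6
  linarith

/-- One step of the auxiliary mirror descent, with no composite term. -/
theorem dual_step (h : IsProxProblem c r v v' X fun _ => 0) {β : ℝ} (hβ : 0 < β) {x : E}
    (hx : x ∈ subgradientDomain (closedBall c r) v) (ξ : StrongDual ℝ E) {u : E} (hu : u ∈ X) :
    β⁻¹ * ξ (u - x) ≤ bregman v v' x u
      - bregman v v' (compositeProx X (fun _ => 0) v v' β x (-ξ)) u
      + 1 / 2 * (β⁻¹ * (β⁻¹ * ‖ξ‖ ^ 2)) := by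
  have h1 := h.compositeProx_three_point hβ x (-ξ) hu
  have h2 := h.proxy.half_sq_le_bregman hx (h.subset (h.compositeProx_mem hβ x (-ξ)).1)
  set y := compositeProx X (fun _ => 0) v v' β x (-ξ)
  have h3 : ξ (y - x) ≤ ‖ξ‖ * ‖y - x‖ := (le_abs_self _).trans (ξ.le_opNorm (y - x))
  -- Here the whole divergence is available, hence the coefficient `1/2`. With the coefficient `1`
  -- of the primal step it makes up the `3/2` used later.
  have h4 : ‖ξ‖ * ‖y - x‖ ≤ 1 / 2 * (β⁻¹ * ‖ξ‖ ^ 2) + β * ‖y - x‖ ^ 2 / 2 := by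
    have : 1 / 2 * (β⁻¹ * ‖ξ‖ ^ 2) + β * ‖y - x‖ ^ 2 / 2 - ‖ξ‖ * ‖y - x‖
        = β⁻¹ * (‖ξ‖ - β * ‖y - x‖) ^ 2 / 2 := by field_simp; ring
    have h5 : 0 ≤ β⁻¹ * (‖ξ‖ - β * ‖y - x‖) ^ 2 / 2 := by positivity
    linarith
  have h5 := mul_le_mul_of_nonneg_left h2 hβ.le
  have e : (-ξ) (y - u) = ξ (u - x) - ξ (y - x) := by
    simp only [map_sub, neg_apply]; ring
  rw [e] at h1
  have h6 := mul_le_mul_of_nonneg_left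
    (show ξ (u - x) ≤ β * (bregman v v' x u - bregman v v' y u) + 1 / 2 * (β⁻¹ * ‖ξ‖ ^ 2) by
      linarith) (inv_nonneg.2 hβ.le)
  rw [mul_add, inv_mul_cancel_left₀ hβ.ne'] at h6
  linarith

end IsProxProblem

end Prox

/-! ### Exponential deviations along a recursion with independent inputs. -/

section Chain

variable {S Ω : Type*}

/-- The trajectory of the controlled recursion `s_{i+1} = T s_i w_i`. -/
def chain (T : S → Ω → S) (s : S) {N : ℕ} (w : Fin N → Ω) : Fin (N + 1) → S :=
  Fin.induction (motive := fun _ => S) s fun i x => T x (w i)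

@[simp] theorem chain_zero (T : S → Ω → S) (s : S) {N : ℕ} (w : Fin N → Ω) :
    chain T s w 0 = s := rfl

@[simp] theorem chain_succ (T : S → Ω → S) (s : S) {N : ℕ} (w : Fin N → Ω) (i : Fin N) :
    chain T s w i.succ = T (chain T s w i.castSucc) (w i) := rfl

theorem chain_cons_succ (T : S → Ω → S) (s : S) {N : ℕ} (a : Ω) (w : Fin N → Ω)
    (j : Fin (N + 1)) :
    chain T s (Fin.cons a w : Fin (N + 1) → Ω) j.succ = chain T (T s a) w j := by
  induction j using Fin.induction with
  | zero => rw [chain_succ]; simp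
  | succ i ih =>
    rw [chain_succ, Fin.castSucc_succ, ih, Fin.cons_succ, chain_succ]

variable [MeasurableSpace S] [MeasurableSpace Ω]

theorem measurable_chain {T : S → Ω → S} (hT : Measurable fun p : S × Ω => T p.1 p.2) (s : S)
    {N : ℕ} (j : Fin (N + 1)) : Measurable fun w : Fin N → Ω => chain T s w j := by
  induction j using Fin.induction with
  | zero => exact measurable_const
  | succ i ih => exact hT.comp (ih.prodMk (measurable_pi_apply i))

open scoped ENNReal in
/-- If the conditional expectations of the factors are bounded by `C`, then the expectation of their
product along the trajectory is bounded by `C ^ N`. -/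
theorem lintegral_prod_chain_le {P : Measure Ω} [IsProbabilityMeasure P] {T : S → Ω → S}
    (hT : Measurable fun p : S × Ω => T p.1 p.2) {h : S → Ω → ℝ≥0∞}
    (hh : Measurable fun p : S × Ω => h p.1 p.2) {C : ℝ≥0∞}
    (hC : ∀ s, ∫⁻ ω, h s ω ∂P ≤ C) (N : ℕ) (s : S) :
    ∫⁻ w, ∏ i : Fin N, h (chain T s w i.castSucc) (w i) ∂(Measure.pi fun _ : Fin N => P)
      ≤ C ^ N := by
  have meas : ∀ (N : ℕ) (s : S), Measurable fun w : Fin N → Ω =>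
      ∏ i : Fin N, h (chain T s w i.castSucc) (w i) := fun N s =>
    Finset.measurable_fun_prod _ fun i _ =>
      hh.comp ((measurable_chain hT s i.castSucc).prodMk (measurable_pi_apply i))
  induction N generalizing s with
  | zero => simp
  | succ N ih =>
    -- The first query is split off: the rest of the trajectory is the same recursion started at `T
    -- s a`. The induction over all starting states thus replaces conditional expectations.
    have mp := (measurePreserving_piFinSuccAbove (fun _ : Fin (N + 1) => P) 0).symm
    rw [← mp.lintegral_comp (meas (N + 1) s)]
    refine (lintegral_prod _ ((meas (N + 1) s).comp mp.measurable).aemeasurable).trans_le ?_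
    have e : ∀ (a : Ω) (w : Fin N → Ω),
        (MeasurableEquiv.piFinSuccAbove (fun _ : Fin (N + 1) => Ω) 0).symm (a, w)
          = (Fin.cons a w : Fin (N + 1) → Ω) := fun a w => by
      simp [MeasurableEquiv.piFinSuccAbove]
      rfl
    calc _ = ∫⁻ a, ∫⁻ w, h s a * ∏ i : Fin N, h (chain T (T s a) w i.castSucc) (w i)
          ∂(Measure.pi fun _ : Fin N => P) ∂P := by
          refine lintegral_congr fun a => ?_
          refine lintegral_congr fun w => ?_
          rw [Function.comp_apply, e, Fin.prod_univ_succ]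
          congr 1
          refine Finset.prod_congr rfl fun i _ => ?_
          rw [Fin.castSucc_succ, chain_cons_succ, Fin.cons_succ]
      _ ≤ ∫⁻ a, h s a * C ^ N ∂P := by
          refine lintegral_mono fun a => ?_
          rw [lintegral_const_mul _ (meas N (T s a))]
          gcongr
          exact ih _
      _ = (∫⁻ a, h s a ∂P) * C ^ N :=
          lintegral_mul_const _ (hh.comp (measurable_const.prodMk measurable_id))
      _ ≤ C ^ (N + 1) := by
          rw [pow_succ']
          gcongr
          exact hC s

/-- Exponential deviation bound for additive functionals of a trajectory. -/
theorem exists_event_sum_chain_le {P : Measure Ω} [IsProbabilityMeasure P] {T : S → Ω → S}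
    (hT : Measurable fun p : S × Ω => T p.1 p.2) {u : S → Ω → ℝ}
    (hu : Measurable fun p : S × Ω => u p.1 p.2) {q : ℝ}
    (hq : ∀ s, ∫⁻ ω, ENNReal.ofReal (Real.exp (u s ω)) ∂P ≤ ENNReal.ofReal (Real.exp q))
    (N : ℕ) (s : S) (τ : ℝ) :
    ∃ A : Set (Fin N → Ω), MeasurableSet A ∧
      1 - Real.exp (-τ) ≤ (Measure.pi fun _ : Fin N => P).real A ∧
      ∀ w ∈ A, ∑ i : Fin N, u (chain T s w i.castSucc) (w i) ≤ N * q + τ := by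
  set μ := Measure.pi fun _ : Fin N => P
  set Z : (Fin N → Ω) → ℝ := fun w => ∑ i : Fin N, u (chain T s w i.castSucc) (w i)
  have hZ : Measurable Z := Finset.measurable_fun_sum _ fun i _ =>
    hu.comp ((measurable_chain hT s i.castSucc).prodMk (measurable_pi_apply i))
  have hA : MeasurableSet {w | Z w ≤ N * q + τ} := measurableSet_le hZ measurable_const
  refine ⟨{w | Z w ≤ N * q + τ}, hA, ?_, fun w hw => hw⟩
  have hexp := lintegral_prod_chain_le hT
    (h := fun s ω => ENNReal.ofReal (Real.exp (u s ω))) (by fun_prop) hq N s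
  have e : ∀ w : Fin N → Ω, ∏ i : Fin N, ENNReal.ofReal (Real.exp (u (chain T s w i.castSucc) (w i)))
      = ENNReal.ofReal (Real.exp (Z w)) := fun w => by
    rw [← ENNReal.ofReal_prod_of_nonneg fun i _ => (Real.exp_pos _).le, ← Real.exp_sum]
  simp only [e] at hexp
  rw [← ENNReal.ofReal_pow (Real.exp_pos _).le, ← Real.exp_nat_mul] at hexp
  have markov := mul_meas_ge_le_lintegral (μ := μ)
    (f := fun w => ENNReal.ofReal (Real.exp (Z w))) (by fun_prop)
    (ENNReal.ofReal (Real.exp (N * q + τ)))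
  have hsub : {w | Z w ≤ N * q + τ}ᶜ
      ⊆ {w | ENNReal.ofReal (Real.exp (N * q + τ)) ≤ ENNReal.ofReal (Real.exp (Z w))} := by
    intro w hw
    simp only [Set.mem_compl_iff, Set.mem_ofPred_eq, not_le] at hw ⊢
    exact ENNReal.ofReal_le_ofReal (Real.exp_le_exp.2 hw.le)
  have h1 : ENNReal.ofReal (Real.exp (N * q + τ)) * μ {w | Z w ≤ N * q + τ}ᶜ
      ≤ ENNReal.ofReal (Real.exp (N * q)) :=
    (mul_le_mul_right (measure_mono hsub) _).trans (markov.trans hexp)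
  have h2 : μ.real {w | Z w ≤ N * q + τ}ᶜ ≤ Real.exp (-τ) := by
    have h3 := ENNReal.toReal_mono ENNReal.ofReal_ne_top h1
    rw [ENNReal.toReal_mul, ENNReal.toReal_ofReal (Real.exp_pos _).le,
      ENNReal.toReal_ofReal (Real.exp_pos _).le, Real.exp_add, mul_assoc] at h3
    have h4 := le_of_mul_le_mul_left (h3.trans_eq (mul_one _).symm) (Real.exp_pos _)
    rw [Real.exp_neg, ← one_div, le_div_iff₀ (Real.exp_pos _), mul_comm]
    exact h4
  rw [probReal_compl_eq_one_sub hA] at h2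
  linarith

/-- A bound for the exponential moment of a bounded random variable by its first two moments. -/
theorem lintegral_exp_le {P : Measure Ω} [IsProbabilityMeasure P] {u : Ω → ℝ} (hu : Measurable u)
    (hb : ∀ ω, |u ω| ≤ 1) {a b : ℝ} (ha : ∫ ω, u ω ∂P ≤ a) (hb2 : ∫ ω, u ω ^ 2 ∂P ≤ b) :
    ∫⁻ ω, ENNReal.ofReal (Real.exp (u ω)) ∂P ≤ ENNReal.ofReal (Real.exp (a + b)) := by
  have i1 : Integrable u P := Integrable.of_bound hu.aestronglyMeasurable 1
    (Filter.Eventually.of_forall hb)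
  have i2 : Integrable (fun ω => u ω ^ 2) P :=
    Integrable.of_bound (hu.pow_const 2).aestronglyMeasurable 1 (Filter.Eventually.of_forall
      fun ω => by
        rw [norm_pow]
        exact pow_le_one₀ (norm_nonneg _) (hb ω))
  have i0 : Integrable (fun ω => 1 + u ω) P := (integrable_const 1).add i1
  have i3 : Integrable (fun ω => 1 + u ω + u ω ^ 2) P := i0.add i2
  have hle : ∀ ω, Real.exp (u ω) ≤ 1 + u ω + u ω ^ 2 := fun ω => by
    have := (abs_le.1 (Real.abs_exp_sub_one_sub_id_le (hb ω))).2
    linarith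
  calc _ ≤ ∫⁻ ω, ENNReal.ofReal (1 + u ω + u ω ^ 2) ∂P :=
        lintegral_mono fun ω => ENNReal.ofReal_le_ofReal (hle ω)
    _ = ENNReal.ofReal (∫ ω, (1 + u ω + u ω ^ 2) ∂P) :=
        (ofReal_integral_eq_lintegral_ofReal i3 (Filter.Eventually.of_forall fun ω =>
          (Real.exp_pos _).le.trans (hle ω))).symm
    _ ≤ _ := by
        refine ENNReal.ofReal_le_ofReal ?_
        rw [integral_add i0 i2, integral_add (integrable_const 1) i1]
        have := Real.add_one_le_exp (a + b)
        simp only [integral_const, probReal_univ, one_smul]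
        linarith

end Chain

/-! ### Bias and second moment of a truncated random vector. -/

section Truncation

variable {Ω : Type*} {V : Type*} [NormedAddCommGroup V]

open Classical in
/-- Truncation of the random vector `H` at distance `ρ` from `g`. -/
noncomputable def truncateAt (H : Ω → V) (g : V) (ρ : ℝ) (ω : Ω) : V :=
  if ‖H ω - g‖ ≤ ρ then H ω else g

theorem norm_truncateAt_sub_le (H : Ω → V) {g A : V} {d ρ : ℝ} (hg : ‖g - A‖ ≤ d) (hρ : 0 ≤ ρ)
    (ω : Ω) : ‖truncateAt H g ρ ω - A‖ ≤ ρ + d := by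
  unfold truncateAt
  split_ifs with h
  · exact (norm_sub_le_norm_sub_add_norm_sub _ g _).trans (add_le_add h hg)
  · linarith

theorem lt_norm_sub_of_not_le {H : Ω → V} {g A : V} {d l : ℝ} (hg : ‖g - A‖ ≤ d) {ω : Ω}
    (h : ¬ ‖H ω - g‖ ≤ d + l) : l < ‖H ω - A‖ := by
  have := norm_sub_le_norm_sub_add_norm_sub (H ω) A g
  rw [norm_sub_rev A g] at this
  linarith

/-- When `H` is rejected, the substitute `g` is off by at most `d ≤ 3l`, whereas `H` itself was off
by more than `l`. -/
theorem norm_truncateAt_sub_sq_le (H : Ω → V) {g A : V} {d l : ℝ} (hg : ‖g - A‖ ≤ d)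
    (hd : d ≤ 3 * l) (ω : Ω) :
    ‖truncateAt H g (d + l) ω - A‖ ^ 2 ≤ 9 * ‖H ω - A‖ ^ 2 := by
  unfold truncateAt
  split_ifs with h
  · nlinarith [norm_nonneg (H ω - A)]
  · have := lt_norm_sub_of_not_le hg h
    nlinarith [norm_nonneg (H ω - A), norm_nonneg (g - A)]

/-- Upon rejection `‖g - H‖ ≤ d + ‖H - A‖ ≤ 4‖H - A‖`, and one more factor `‖H - A‖/l > 1` makes the
bound quadratic. Its expectation is then controlled by the variance. -/
theorem norm_truncateAt_sub_self_le (H : Ω → V) {g A : V} {d l : ℝ} (hg : ‖g - A‖ ≤ d)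
    (hl : 0 < l) (hd : d ≤ 3 * l) (ω : Ω) :
    ‖truncateAt H g (d + l) ω - H ω‖ ≤ 4 / l * ‖H ω - A‖ ^ 2 := by
  unfold truncateAt
  split_ifs with h
  · rw [sub_self, norm_zero]; positivity
  · have h1 := lt_norm_sub_of_not_le hg h
    have h2 := norm_sub_le_norm_sub_add_norm_sub g A (H ω)
    rw [norm_sub_rev A (H ω)] at h2
    rw [div_mul_eq_mul_div, le_div_iff₀ hl]
    nlinarith [norm_nonneg (H ω - A)]

variable [MeasurableSpace Ω]

theorem integral_norm_truncateAt_sub_sq_le {P : Measure Ω} {H : Ω → V} {g A : V} {d l σ : ℝ}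
    (hg : ‖g - A‖ ≤ d) (hd : d ≤ 3 * l) (i : Integrable (fun ω => ‖H ω - A‖ ^ 2) P)
    (hσ : ∫ ω, ‖H ω - A‖ ^ 2 ∂P ≤ σ ^ 2) :
    ∫ ω, ‖truncateAt H g (d + l) ω - A‖ ^ 2 ∂P ≤ 9 * σ ^ 2 := by
  calc _ ≤ ∫ ω, 9 * ‖H ω - A‖ ^ 2 ∂P :=
        integral_mono_of_nonneg (Filter.Eventually.of_forall fun _ => by positivity)
          (i.const_mul 9) (Filter.Eventually.of_forall (norm_truncateAt_sub_sq_le H hg hd))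
    _ ≤ _ := by
        rw [integral_const_mul]
        linarith

/-- As `H` is unbiased, the bias is the mean of the change made by the truncation. -/
theorem norm_integral_truncateAt_sub_le [NormedSpace ℝ V] [CompleteSpace V] {P : Measure Ω}
    [IsProbabilityMeasure P] {H : Ω → V} {g A : V} {d l σ : ℝ}
    (hg : ‖g - A‖ ≤ d) (hl : 0 < l) (hd : d ≤ 3 * l) (hH : Integrable H P)
    (hA : ∫ ω, H ω ∂P = A) (hY : Integrable (fun ω => truncateAt H g (d + l) ω) P)
    (i : Integrable (fun ω => ‖H ω - A‖ ^ 2) P)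
    (hσ : ∫ ω, ‖H ω - A‖ ^ 2 ∂P ≤ σ ^ 2) :
    ‖∫ ω, (truncateAt H g (d + l) ω - A) ∂P‖ ≤ 4 / l * σ ^ 2 := by
  have e : ∫ ω, (truncateAt H g (d + l) ω - A) ∂P = ∫ ω, (truncateAt H g (d + l) ω - H ω) ∂P := by
    rw [integral_sub hY (integrable_const A), integral_sub hY hH, hA, integral_const,
      probReal_univ, one_smul]
  rw [e]
  calc _ ≤ ∫ ω, 4 / l * ‖H ω - A‖ ^ 2 ∂P :=
        norm_integral_le_of_norm_le (i.const_mul _)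
          (Filter.Eventually.of_forall (norm_truncateAt_sub_self_le H hg hl hd))
    _ ≤ _ := by
        rw [integral_const_mul]
        gcongr

end Truncation

/-! ### Smooth convex functions and the accuracy certificate. -/

section Smooth

variable {E : Type*} [NormedAddCommGroup E] [NormedSpace ℝ E]

/-- The gradient inequality for a convex function differentiable relative to its domain. -/
theorem ConvexOn.add_fderivWithin_le {X : Set E} {f : E → ℝ} (hf : ConvexOn ℝ X f) {x y : E}
    {f' : StrongDual ℝ E} (hx : x ∈ X) (hy : y ∈ X) (hd : HasFDerivWithinAt f f' X x) :
    f x + f' (y - x) ≤ f y := by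
  have h1 := hf.comp_affineMap (AffineMap.lineMap x y : ℝ →ᵃ[ℝ] E)
  have h2 : HasDerivWithinAt (f ∘ (AffineMap.lineMap x y : ℝ →ᵃ[ℝ] E)) (f' (y - x))
      ((AffineMap.lineMap x y : ℝ →ᵃ[ℝ] E) ⁻¹' X) 0 := by
    refine HasFDerivWithinAt.comp_hasDerivWithinAt (t := X) (0 : ℝ) ?_
      (AffineMap.hasDerivWithinAt_lineMap) (fun t ht => ht)
    simpa using hd
  have h3 := h1.le_slope_of_hasDerivWithinAt (x := 0) (y := 1) (by simpa using hx)
    (by simpa using hy) zero_lt_one h2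
  simp [slope_def_field] at h3
  rw [map_sub]
  linarith

variable {Ω : Type*} [MeasurableSpace Ω] {P : Measure Ω} {X : Set E} {Φ : E → Ω → ℝ}
  {φ' : E → StrongDual ℝ E} {L : ℝ}

/-- The quadratic upper bound for a smooth convex function. -/
theorem IsSmoothPart.le_add_sq (h : IsSmoothPart P X Φ φ' L) {x y : E} (hx : x ∈ X) (hy : y ∈ X) :
    ∫ w, Φ y w ∂P ≤ ∫ w, Φ x w ∂P + φ' x (y - x) + L * ‖y - x‖ ^ 2 / 2 := by
  set φ : E → ℝ := fun x => ∫ w, Φ x w ∂P with hφ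
  have mem : ∀ t : ℝ, 0 ≤ t → t ≤ 1 → y + t • (x - y) ∈ X := fun t h0 h1 => by
    have e : y + t • (x - y) = (1 - t) • y + t • x := by module
    rw [e]
    exact h.convexOn.1 hy hx (by linarith) h0 (by ring)
  -- The segment is run backwards, from `y` to `x`: the gradient inequality bounds increments from
  -- below, which here gives an upper bound for `φ y`.
  have key := add_half_le_sub_of_increments (h := fun t : ℝ => φ (y + t • (x - y)))
    (a := -(φ' x (y - x) + L * ‖y - x‖ ^ 2)) (b := L * ‖y - x‖ ^ 2) fun s t hs hst ht => by
      have hps := mem s hs (hst.le.trans ht)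
      have hpt := mem t (hs.trans hst.le) ht
      have h1 := h.convexOn.add_fderivWithin_le hps hpt (h.hasGradient _ hps)
      have e : y + t • (x - y) - (y + s • (x - y)) = -((t - s) • (y - x)) := by module
      rw [e, map_neg, map_smul, smul_eq_mul] at h1
      have h2 : φ' (y + s • (x - y)) (y - x) ≤ φ' x (y - x) + L * ‖y - x‖ ^ 2 * (1 - s) := by
        have h3 := h.lipschitz _ hx _ hps
        have e2 : x - (y + s • (x - y)) = -((1 - s) • (y - x)) := by module
        rw [e2, norm_neg, norm_smul, Real.norm_of_nonneg (by linarith)] at h3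
        have h4 := (le_abs_self _).trans ((φ' (y + s • (x - y)) - φ' x).le_opNorm (y - x))
        rw [sub_apply] at h4
        have h5 := mul_le_mul_of_nonneg_right h3 (norm_nonneg (y - x))
        nlinarith
      have h6 := mul_le_mul_of_nonneg_left h2 (sub_pos.2 hst).le
      change (t - s) * _ ≤ φ _ - φ _
      linarith
  simp only [one_smul, zero_smul, add_zero, add_sub_cancel] at key
  change φ y ≤ φ x + _ + _
  linarith

theorem IsSmoothPart.continuousOn_grad (h : IsSmoothPart P X Φ φ' L) : ContinuousOn φ' X :=
  (LipschitzOnWith.of_dist_le_mul (K := L.toNNReal) fun x hx y hy => by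
    rw [dist_comm, dist_eq_norm, dist_eq_norm]
    exact (h.lipschitz x hx y hy).trans
      (mul_le_mul_of_nonneg_right (Real.le_coe_toNNReal L) (norm_nonneg _))).continuousOn

open Metric in
/-- The accuracy certificate bounds the suboptimality of the average of the iterates. -/
theorem objective_weightedAverage_sub_le (h : IsSmoothPart P X Φ φ' L) {ψ : E → ℝ}
    {c : E} {r : ℝ} {v : E → ℝ} {v' : E → StrongDual ℝ E} (hp : IsProxProblem c r v v' X ψ)
    {β : ℝ} (hβ : 0 < β) (hL : 2 * L ≤ β) {N : ℕ} (hN : 1 ≤ N) {x : Fin (N + 1) → E}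
    (hx : ∀ i, x i ∈ X ∩ subgradientDomain (closedBall c r) v) {u : E} (hu : u ∈ X) :
    objective P Φ ψ (weightedAverage (fun _ : Fin N => β) x) - objective P Φ ψ u
      ≤ β / N * accuracyCertificate φ' ψ v v' (fun _ : Fin N => β) x u := by
  have hN' : (0 : ℝ) < N := by exact_mod_cast hN
  have hF : ConvexOn ℝ X (objective P Φ ψ) := h.convexOn.add hp.convexOn
  have havg : weightedAverage (fun _ : Fin N => β) x
      = ∑ i : Fin N, (N : ℝ)⁻¹ • x i.succ := by
    simp only [weightedAverage, Finset.sum_const, Finset.card_univ, Fintype.card_fin,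
      ← Finset.smul_sum, smul_smul, nsmul_eq_mul]
    congr 1
    field_simp
  have hj : objective P Φ ψ (weightedAverage (fun _ : Fin N => β) x)
      ≤ ∑ i : Fin N, (N : ℝ)⁻¹ • objective P Φ ψ (x i.succ) := by
    rw [havg]
    refine hF.map_sum_le (fun _ _ => by positivity) ?_ fun i _ => (hx _).1
    simp [hN'.ne']
  have step : ∀ i : Fin N, objective P Φ ψ (x i.succ) - objective P Φ ψ u
      ≤ β * (β⁻¹ * (φ' (x i.castSucc) (x i.succ - u) + ψ (x i.succ) - ψ u)
        + 1 / 2 * bregman v v' (x i.castSucc) (x i.succ)) := by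
    intro i
    have h1 := h.le_add_sq (hx i.castSucc).1 (hx i.succ).1
    have h2 := h.convexOn.add_fderivWithin_le (hx i.castSucc).1 hu (h.hasGradient _ (hx _).1)
    have h3 := hp.proxy.half_sq_le_bregman (hx i.castSucc).2 (hp.subset (hx i.succ).1)
    have e : φ' (x i.castSucc) (x i.succ - u)
        = φ' (x i.castSucc) (x i.succ - x i.castSucc) - φ' (x i.castSucc) (u - x i.castSucc) := by
      rw [← map_sub]; congr 1; abel
    rw [mul_add, mul_inv_cancel_left₀ hβ.ne', e]
    -- The curvature term satisfies `(L/2)‖·‖² ≤ (β/4)‖·‖² ≤ (β/2)V`. This is where `2 * L ≤ β` is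
    -- needed.
    have h4 := mul_le_mul_of_nonneg_left h3 hβ.le
    have h5 := mul_le_mul_of_nonneg_right hL (sq_nonneg ‖x i.succ - x i.castSucc‖)
    simp only [objective]
    linarith
  calc _ ≤ ∑ i : Fin N, (N : ℝ)⁻¹ • objective P Φ ψ (x i.succ) - objective P Φ ψ u := by
        linarith
    _ = (N : ℝ)⁻¹ * ∑ i : Fin N, (objective P Φ ψ (x i.succ) - objective P Φ ψ u) := by
        rw [Finset.sum_sub_distrib, mul_sub, Finset.mul_sum]
        simp only [smul_eq_mul, Finset.sum_const, Finset.card_univ, Fintype.card_fin, nsmul_eq_mul]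
        field_simp
    _ ≤ (N : ℝ)⁻¹ * ∑ i : Fin N, _ :=
        mul_le_mul_of_nonneg_left (Finset.sum_le_sum fun i _ => step i) (by positivity)
    _ = _ := by
        rw [accuracyCertificate, ← Finset.mul_sum, ← mul_assoc, div_eq_inv_mul β]

theorem sum_castSucc_sub_succ {N : ℕ} (f : Fin (N + 1) → ℝ) :
    ∑ i : Fin N, (f i.castSucc - f i.succ) = f 0 - f (Fin.last N) := by
  have h1 := Fin.sum_univ_castSucc f
  have h2 := Fin.sum_univ_succ f
  rw [Finset.sum_sub_distrib]
  linarith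

open Metric in
/-- A bound of the accuracy certificate which depends on the test point `u` only through the initial
Bregman divergences. The sequence `z` is an auxiliary mirror descent driven by the errors `ξ`. -/
theorem accuracyCertificate_le [FiniteDimensional ℝ E] {ψ : E → ℝ}
    {c : E} {r : ℝ} {v : E → ℝ} {v' : E → StrongDual ℝ E} (hp : IsProxProblem c r v v' X ψ)
    (hp0 : IsProxProblem c r v v' X fun _ => 0)
    {β : ℝ} (hβ : 0 < β) {N : ℕ} {x z : Fin (N + 1) → E} {ξ : Fin N → StrongDual ℝ E}
    (hx : ∀ i, x i ∈ X ∩ subgradientDomain (closedBall c r) v)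
    (hz : ∀ i, z i ∈ X ∩ subgradientDomain (closedBall c r) v)
    (hxs : ∀ i : Fin N, x i.succ
      = compositeProx X ψ v v' β (x i.castSucc) (φ' (x i.castSucc) + ξ i))
    (hzs : ∀ i : Fin N, z i.succ
      = compositeProx X (fun _ => 0) v v' β (z i.castSucc) (-ξ i)) {u : E} (hu : u ∈ X) :
    accuracyCertificate φ' ψ v v' (fun _ : Fin N => β) x u
      ≤ bregman v v' (x 0) u + bregman v v' (z 0) u
        + β⁻¹ * ∑ i : Fin N, (ξ i (z i.castSucc - x i.castSucc) + 3 / 2 * β⁻¹ * ‖ξ i‖ ^ 2) := by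
  have nn : ∀ y : E, y ∈ X ∩ subgradientDomain (closedBall c r) v → 0 ≤ bregman v v' y u :=
    fun y hy => le_trans (by positivity) (hp.proxy.half_sq_le_bregman hy.2 (hp.subset hu))
  set f : Fin (N + 1) → ℝ := fun i => bregman v v' (x i) u + bregman v v' (z i) u with hf
  have step : ∀ i : Fin N, β⁻¹ * (φ' (x i.castSucc) (x i.succ - u) + ψ (x i.succ) - ψ u)
        + 1 / 2 * bregman v v' (x i.castSucc) (x i.succ)
      ≤ (f i.castSucc - f i.succ)
        + β⁻¹ * (ξ i (z i.castSucc - x i.castSucc) + 3 / 2 * β⁻¹ * ‖ξ i‖ ^ 2) := by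
    intro i
    have h1 := hp.primal_step hβ (hx i.castSucc).2 (φ' (x i.castSucc)) (ξ i) hu
    have h2 := hp0.dual_step hβ (hz i.castSucc).2 (ξ i) hu
    rw [← hxs i] at h1
    rw [← hzs i] at h2
    have e : ξ i (z i.castSucc - x i.castSucc) = ξ i (u - x i.castSucc) - ξ i (u - z i.castSucc) := by
      rw [← map_sub]; congr 1; abel
    rw [e]
    simp only [hf]
    linarith
  calc _ ≤ ∑ i : Fin N, _ := Finset.sum_le_sum fun i _ => step i
    _ = f 0 - f (Fin.last N) + β⁻¹ * ∑ i : Fin N,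
        (ξ i (z i.castSucc - x i.castSucc) + 3 / 2 * β⁻¹ * ‖ξ i‖ ^ 2) := by
        rw [Finset.sum_add_distrib, sum_castSucc_sub_succ, Finset.mul_sum]
    _ ≤ _ := by
        have h1 := nn _ (hx (Fin.last N))
        have h2 := nn _ (hz (Fin.last N))
        simp only [hf]
        linarith

end Smooth

/-! ### Exponential moment of one increment. -/

section Increment

variable {E : Type*} [NormedAddCommGroup E] [NormedSpace ℝ E] {Ω : Type*} [MeasurableSpace Ω]

theorem measurable_truncateAt [FiniteDimensional ℝ E] {H : Ω → StrongDual ℝ E} (hH : Measurable H)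
    (g : StrongDual ℝ E) (ρ : ℝ) : Measurable (truncateAt H g ρ) :=
  Measurable.ite (measurableSet_le (hH.sub_const g).norm measurable_const) hH measurable_const

/-- Exponential moment bound for the increments of the deviation functional. -/
theorem lintegral_exp_truncateAt_le [FiniteDimensional ℝ E] {P : Measure Ω} [IsProbabilityMeasure P]
    {H : Ω → StrongDual ℝ E} {g A : StrongDual ℝ E} {d l σ R K κ p : ℝ} {e : E}
    (hR : 0 < R) (hK : 0 < K) (hκ : 0 ≤ κ) (hKl : K ≤ l) (hd : d ≤ 3 * l) (hdK : 2 * d + l ≤ 8 * K)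
    (hp : σ ^ 2 ≤ p * K ^ 2) (he : ‖e‖ ≤ 2 * R) (hg : ‖g - A‖ ≤ d)
    (hHm : Measurable H) (hH : Integrable H P) (hA : ∫ ω, H ω ∂P = A)
    (i : Integrable (fun ω => ‖H ω - A‖ ^ 2) P) (hσ : ∫ ω, ‖H ω - A‖ ^ 2 ∂P ≤ σ ^ 2) :
    ∫⁻ ω, ENNReal.ofReal (Real.exp ((32 * K * R + 128 * κ * K ^ 2)⁻¹ *
      ((truncateAt H g (d + l) ω - A) e + κ * ‖truncateAt H g (d + l) ω - A‖ ^ 2))) ∂P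
      ≤ ENNReal.ofReal (Real.exp (p / 2)) := by
  have hl : 0 < l := hK.trans_le hKl
  have hd0 : 0 ≤ d := (norm_nonneg _).trans hg
  have : CompleteSpace (StrongDual ℝ E) := FiniteDimensional.complete ℝ _
  have hDpos : 0 < 32 * K * R + 128 * κ * K ^ 2 := by positivity
  set t := (32 * K * R + 128 * κ * K ^ 2)⁻¹ with ht
  have ht0 : 0 < t := inv_pos.2 hDpos
  have ht1 : t * (32 * K * R + 128 * κ * K ^ 2) = 1 := inv_mul_cancel₀ hDpos.ne'
  have hYm := measurable_truncateAt hHm g (d + l)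
  set ξ : Ω → StrongDual ℝ E := fun ω => truncateAt H g (d + l) ω - A with hξ
  have hξm : Measurable ξ := hYm.sub_const A
  have hb : ∀ ω, ‖ξ ω‖ ≤ 8 * K := fun ω =>
    (norm_truncateAt_sub_le H hg (by positivity) ω).trans (by linarith)
  have hξi : Integrable ξ P := Integrable.of_bound hξm.aestronglyMeasurable (8 * K)
    (Filter.Eventually.of_forall hb)
  have hYi : Integrable (fun ω => truncateAt H g (d + l) ω) P := by
    have := hξi.add (integrable_const A)
    refine this.congr (Filter.Eventually.of_forall fun ω => ?_)
    simp [hξ]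
  have m1 := norm_integral_truncateAt_sub_le hg hl hd hH hA hYi i hσ
  have m2 := integral_norm_truncateAt_sub_sq_le hg hd i hσ
  change ‖∫ ω, ξ ω ∂P‖ ≤ _ at m1
  change ∫ ω, ‖ξ ω‖ ^ 2 ∂P ≤ _ at m2
  have hξ2i : Integrable (fun ω => ‖ξ ω‖ ^ 2) P :=
    Integrable.of_bound (hξm.norm.pow_const 2).aestronglyMeasurable ((8 * K) ^ 2)
      (Filter.Eventually.of_forall fun ω => by
        rw [norm_pow, norm_norm]
        gcongr
        exact hb ω)
  have habs : ∀ ω, |t * (ξ ω e + κ * ‖ξ ω‖ ^ 2)| ≤ t * ‖ξ ω‖ * (2 * R + 8 * κ * K) := by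
    intro ω
    have h1 : |ξ ω e| ≤ ‖ξ ω‖ * (2 * R) :=
      ((ξ ω).le_opNorm e).trans (mul_le_mul_of_nonneg_left he (norm_nonneg _))
    have h2 : κ * ‖ξ ω‖ ^ 2 ≤ ‖ξ ω‖ * (8 * κ * K) := by
      have := mul_le_mul_of_nonneg_left (hb ω) (mul_nonneg hκ (norm_nonneg (ξ ω)))
      linarith
    rw [abs_mul, abs_of_pos ht0, mul_assoc]
    refine mul_le_mul_of_nonneg_left ((abs_add_le _ _).trans ?_) ht0.le
    rw [abs_of_nonneg (by positivity : 0 ≤ κ * ‖ξ ω‖ ^ 2)]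
    linarith
  -- With `‖ξ‖ ≤ 8K` this bounds the scaled increment by `1/2`. Its second moment is then at most
  -- `9p/256`. Its mean is at most `t(8pKR + 9κpK²) ≤ p/4`, so both fit into `p/4`.
  have hscale : t * K * (2 * R + 8 * κ * K) = 1 / 16 := by linarith
  have bK : 0 ≤ t * κ * K ^ 2 := by positivity
  have p0 : 0 ≤ p := by
    by_contra hneg
    have : p * K ^ 2 < 0 := mul_neg_of_neg_of_pos (not_le.1 hneg) (by positivity)
    linarith [sq_nonneg σ]
  have main := lintegral_exp_le (P := P) (u := fun ω => t * (ξ ω e + κ * ‖ξ ω‖ ^ 2))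
    (a := p / 4) (b := p / 4) ?_ ?_ ?_ ?_
  · rwa [show p / 4 + p / 4 = p / 2 by ring] at main
  · have h1 : Measurable fun ω => ξ ω e := (ContinuousLinearMap.measurable_apply e).comp hξm
    exact (h1.add ((hξm.norm.pow_const 2).const_mul κ)).const_mul t
  · intro ω
    refine (habs ω).trans ?_
    have := mul_le_mul_of_nonneg_left (hb ω) (by positivity : 0 ≤ t * (2 * R + 8 * κ * K))
    linarith
  · rw [integral_const_mul, integral_add (hξi.apply_continuousLinearMap e) (hξ2i.const_mul κ),
      integral_const_mul, ← ContinuousLinearMap.integral_apply hξi]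
    have h1 : (∫ ω, ξ ω ∂P) e ≤ 4 * p * K * (2 * R) := by
      refine (le_abs_self _).trans (((∫ ω, ξ ω ∂P).le_opNorm e).trans ?_)
      have h2 : 4 / l * σ ^ 2 ≤ 4 * p * K := by
        calc 4 / l * σ ^ 2 ≤ 4 / K * (p * K ^ 2) := by gcongr
          _ = _ := by field_simp
      exact mul_le_mul (m1.trans h2) he (norm_nonneg _) (by positivity)
    have h3 : κ * ∫ ω, ‖ξ ω‖ ^ 2 ∂P ≤ κ * (9 * (p * K ^ 2)) :=
      mul_le_mul_of_nonneg_left (m2.trans (by linarith)) hκ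
    have h4 := mul_le_mul_of_nonneg_left (add_le_add h1 h3) ht0.le
    have h5 : t * (4 * p * K * (2 * R) + κ * (9 * (p * K ^ 2)))
        = p / 4 * (t * (32 * K * R + 128 * κ * K ^ 2)) - 23 * p * (t * κ * K ^ 2) := by ring
    rw [ht1] at h5
    nlinarith [mul_nonneg p0 bK]
  · calc ∫ ω, (t * (ξ ω e + κ * ‖ξ ω‖ ^ 2)) ^ 2 ∂P
        ≤ ∫ ω, (t * (2 * R + 8 * κ * K)) ^ 2 * ‖ξ ω‖ ^ 2 ∂P := by
          refine integral_mono_of_nonneg (Filter.Eventually.of_forall fun _ => by positivity)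
            (hξ2i.const_mul _) (Filter.Eventually.of_forall fun ω => ?_)
          have := pow_le_pow_left₀ (abs_nonneg _) (habs ω) 2
          rw [sq_abs] at this
          refine this.trans (le_of_eq ?_)
          ring
      _ ≤ (t * (2 * R + 8 * κ * K)) ^ 2 * (9 * (p * K ^ 2)) := by
          rw [integral_const_mul]
          gcongr
          linarith
      _ = 9 * p * (t * K * (2 * R + 8 * κ * K)) ^ 2 := by ring
      _ ≤ p / 4 := by rw [hscale]; linarith

end Increment

/-! ### The pair of mirror descents as a measurable recursion. -/

section State

open Metric

variable {E : Type*} [NormedAddCommGroup E] [NormedSpace ℝ E] [FiniteDimensional ℝ E]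
  {Ω : Type*} {c : E} {r : ℝ} {v : E → ℝ} {v' : E → StrongDual ℝ E} {X : Set E} {ψ : E → ℝ}

/-- The state space of the mirror descent iterates. -/
abbrev ProxState (c : E) (r : ℝ) (v : E → ℝ) (X : Set E) : Type _ :=
  ↥(X ∩ subgradientDomain (closedBall c r) v)

/-- The proximal step as a map into the state space. -/
noncomputable def IsProxProblem.step (h : IsProxProblem c r v v' X ψ) {β : ℝ} (hβ : 0 < β)
    (x : ProxState c r v X) (ξ : StrongDual ℝ E) : ProxState c r v X :=
  ⟨compositeProx X ψ v v' β x ξ, h.compositeProx_mem hβ x ξ⟩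

/-- The error of the gradient estimate `y` at the state `x`. -/
def gradError (y : E → Ω → StrongDual ℝ E) (φ' : E → StrongDual ℝ E) (x : E) (ω : Ω) :
    StrongDual ℝ E :=
  y x ω - φ' x

/-- The joint transition of the mirror descent and of the auxiliary mirror descent which is driven
by the errors of the gradient estimates. -/
noncomputable def pairStep (h : IsProxProblem c r v v' X ψ)
    (h0 : IsProxProblem c r v v' X fun _ => 0) {β : ℝ} (hβ : 0 < β)
    (y : E → Ω → StrongDual ℝ E) (φ' : E → StrongDual ℝ E)
    (s : ProxState c r v X × ProxState c r v X) (ω : Ω) :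
    ProxState c r v X × ProxState c r v X :=
  (h.step hβ s.1 (y s.1 ω), h0.step hβ s.2 (-gradError y φ' s.1 ω))

/-- The auxiliary component never feeds back into the first one. -/
theorem mirrorDescent_eq_chain (h : IsProxProblem c r v v' X ψ)
    (h0 : IsProxProblem c r v v' X fun _ => 0) {β : ℝ} (hβ : 0 < β)
    (y : E → Ω → StrongDual ℝ E) (φ' : E → StrongDual ℝ E)
    (s : ProxState c r v X × ProxState c r v X) {N : ℕ} (w : Fin N → Ω) (i : Fin (N + 1)) :
    mirrorDescent X ψ v v' y s.1 (fun _ => β) w i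
      = (chain (pairStep h h0 hβ y φ') s w i).1 := by
  induction i using Fin.induction with
  | zero => rfl
  | succ i ih =>
    rw [chain_succ]
    simp only [mirrorDescent, Fin.induction_succ] at ih ⊢
    rw [ih]
    rfl

variable [MeasurableSpace E] [BorelSpace E]

theorem measurable_restrict_of_continuousOn {E : Type*} [NormedAddCommGroup E] [NormedSpace ℝ E]
    [MeasurableSpace E] [BorelSpace E] {D : Set E} {f : E → StrongDual ℝ E}
    (hf : ContinuousOn f D) : Measurable fun x : D => f x :=
  (continuousOn_iff_continuous_domRestrict.1 hf).measurable

/-- States are confined to the domain where `v'` is continuous, and `proxMap` is continuous in its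
dual argument. -/
theorem IsProxProblem.measurable_step (h : IsProxProblem c r v v' X ψ) {β : ℝ} (hβ : 0 < β)
    {α : Type*} [MeasurableSpace α] {x : α → ProxState c r v X} {ξ : α → StrongDual ℝ E}
    (hx : Measurable x) (hξ : Measurable ξ) : Measurable fun a => h.step hβ (x a) (ξ a) := by
  refine Measurable.subtype_mk ?_
  simp only [compositeProx_eq_proxMap]
  refine (h.continuous_proxMap hβ).measurable.comp (hξ.sub (Measurable.const_smul ?_ β))
  exact (measurable_restrict_of_continuousOn
    (h.proxy.continuousOn_grad.mono Set.inter_subset_right)).comp hx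

variable [MeasurableSpace Ω] {y : E → Ω → StrongDual ℝ E} {φ' : E → StrongDual ℝ E}

theorem measurable_gradError
    (hy : Measurable fun p : ProxState c r v X × Ω => y p.1 p.2) (hφ : ContinuousOn φ' X) :
    Measurable fun p : ProxState c r v X × Ω => gradError y φ' p.1 p.2 :=
  hy.sub ((measurable_restrict_of_continuousOn (hφ.mono Set.inter_subset_left)).comp measurable_fst)

theorem measurable_pairStep (h : IsProxProblem c r v v' X ψ)
    (h0 : IsProxProblem c r v v' X fun _ => 0) {β : ℝ} (hβ : 0 < β)
    (hy : Measurable fun p : ProxState c r v X × Ω => y p.1 p.2) (hφ : ContinuousOn φ' X) :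
    Measurable fun p : (ProxState c r v X × ProxState c r v X) × Ω =>
      pairStep h h0 hβ y φ' p.1 p.2 := by
  have hp : Measurable fun p : (ProxState c r v X × ProxState c r v X) × Ω => (p.1.1, p.2) :=
    (measurable_fst.comp measurable_fst).prodMk measurable_snd
  exact (h.measurable_step hβ (measurable_fst.comp measurable_fst) (hy.comp hp)).prodMk
    (h0.measurable_step hβ (measurable_snd.comp measurable_fst)
      ((measurable_gradError hy hφ).comp hp).neg)

/-- The increment of the deviation functional. -/
noncomputable def deviation (y : E → Ω → StrongDual ℝ E) (φ' : E → StrongDual ℝ E) (κ : ℝ)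
    (s : ProxState c r v X × ProxState c r v X) (ω : Ω) : ℝ :=
  gradError y φ' s.1 ω (s.2 - s.1) + κ * ‖gradError y φ' s.1 ω‖ ^ 2

theorem measurable_deviation
    (hy : Measurable fun p : ProxState c r v X × Ω => y p.1 p.2) (hφ : ContinuousOn φ' X) (κ : ℝ) :
    Measurable fun p : (ProxState c r v X × ProxState c r v X) × Ω =>
      deviation y φ' κ p.1 p.2 := by
  have hp : Measurable fun p : (ProxState c r v X × ProxState c r v X) × Ω => (p.1.1, p.2) :=
    (measurable_fst.comp measurable_fst).prodMk measurable_snd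
  have hξ := (measurable_gradError hy hφ).comp hp
  have : ProperSpace E := FiniteDimensional.proper_real E
  have hd : Measurable fun p : (ProxState c r v X × ProxState c r v X) × Ω =>
      (p.1.2 : E) - p.1.1 :=
    (measurable_subtype_coe.comp (measurable_snd.comp measurable_fst)).sub
      (measurable_subtype_coe.comp (measurable_fst.comp measurable_fst))
  have hev : Measurable fun q : StrongDual ℝ E × E => q.1 q.2 :=
    (isBoundedBilinearMap_apply (𝕜 := ℝ) (E := E) (F := ℝ)).continuous.measurable
  exact (hev.comp (hξ.prodMk hd)).add ((hξ.norm.pow_const 2).const_mul κ)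

end State

/-! ### Range of the rescaled proxy function. -/

section Proxy

open Metric

variable {E : Type*} [NormedAddCommGroup E] [NormedSpace ℝ E]
  {θ : E → ℝ} {θ' : E → StrongDual ℝ E}

theorem IsNormalizedProxy.isProxProblem (h : IsNormalizedProxy θ θ') {c : E} {R : ℝ}
    (hR : 0 < R) {X : Set E} (hX : IsCompact X) (hc : c ∈ X) (hXR : ∀ x ∈ X, ‖x - c‖ ≤ R)
    {ψ : E → ℝ} (hψ : ConvexOn ℝ X ψ) (hψc : ContinuousOn ψ X) :
    IsProxProblem c R (scaledProxy θ c R) (scaledProxyGrad θ' c R) X ψ :=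
  ⟨h.isBallProxy c hR, hX, fun x hx => by simpa [dist_eq_norm] using hXR x hx, hc, hψ, hψc⟩

variable [FiniteDimensional ℝ E]

theorem IsNormalizedProxy.sub_le_proxyRange (h : IsNormalizedProxy θ θ') {x : E}
    (hx : x ∈ closedBall (0 : E) 1) : θ x - θ 0 ≤ proxyRange θ := by
  have : ProperSpace E := FiniteDimensional.proper_real E
  have hc := isCompact_closedBall (0 : E) 1
  exact sub_le_sub (le_csSup (hc.bddAbove_image h.continuousOn) (Set.mem_image_of_mem θ hx))
    (csInf_le (hc.bddBelow_image h.continuousOn)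
      (Set.mem_image_of_mem θ (mem_closedBall_self zero_le_one)))

theorem IsNormalizedProxy.proxyRange_nonneg (h : IsNormalizedProxy θ θ') : 0 ≤ proxyRange θ := by
  have := h.sub_le_proxyRange (mem_closedBall_self zero_le_one)
  linarith

/-- The gradient vanishes at the center, so the divergence from it is a difference of two values of
the proxy. -/
theorem IsNormalizedProxy.bregman_center_le (h : IsNormalizedProxy θ θ') {c u : E} {R : ℝ}
    (hR : 0 < R) (hu : u ∈ closedBall c R) :
    bregman (scaledProxy θ c R) (scaledProxyGrad θ' c R) c u ≤ R ^ 2 * proxyRange θ := by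
  have hu' : R⁻¹ • (u - c) ∈ closedBall (0 : E) 1 := by
    rwa [mem_closedBall, dist_zero_right, norm_smul, norm_inv, Real.norm_of_nonneg hR.le,
      inv_mul_le_iff₀ hR, mul_one, ← dist_eq_norm, ← mem_closedBall]
  rw [bregman, (h.isBallProxy c hR).grad_center, zero_apply, sub_zero, scaledProxy, scaledProxy,
    sub_self, smul_zero, ← mul_sub]
  exact mul_le_mul_of_nonneg_left (h.sub_le_proxyRange hu') (sq_nonneg R)

end Proxy

/-! ### The truncated oracle. -/

section Oracle

variable {E : Type*} [NormedAddCommGroup E] [NormedSpace ℝ E] {Ω : Type*}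

/-- The threshold is grouped as `d + l`, where `d = L‖xbar - x‖ + υσ` bounds the distance from `g`
to the gradient at `x`, and `l = lam` is the margin left for noise. -/
theorem truncatedGrad_eq_truncateAt (G : E → Ω → StrongDual ℝ E) (g : StrongDual ℝ E) (xbar : E)
    (L lam υ σ : ℝ) (x : E) (w : Ω) :
    truncatedGrad G g xbar L lam υ σ x w
      = truncateAt (G x) g ((L * ‖xbar - x‖ + υ * σ) + lam) w := by
  unfold truncatedGrad truncateAt
  simp only [add_right_comm]

variable [MeasurableSpace E] [BorelSpace E] [MeasurableSpace Ω]

theorem measurable_truncatedGrad {X D : Set E} (hD : D ⊆ X) {G : E → Ω → StrongDual ℝ E}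
    (hG : Measurable fun p : X × Ω => G p.1 p.2) (g : StrongDual ℝ E) (xbar : E)
    (L lam υ σ : ℝ) :
    Measurable fun p : D × Ω => truncatedGrad G g xbar L lam υ σ p.1 p.2 := by
  have hG' : Measurable fun p : D × Ω => G p.1 p.2 :=
    hG.comp (f := fun p : D × Ω => ((⟨p.1, hD p.1.2⟩ : X), p.2))
      ((Measurable.subtype_mk (measurable_subtype_coe.comp measurable_fst)).prodMk measurable_snd)
  have hx : Measurable fun p : D × Ω => ‖xbar - (p.1 : E)‖ :=
    ((measurable_subtype_coe.comp measurable_fst).const_sub xbar).norm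
  exact Measurable.ite (measurableSet_le (hG'.sub_const g).norm
    (((hx.const_mul L).add_const lam).add_const (υ * σ))) hG' measurable_const

end Oracle

/-! ### The high probability bound and the choice of the step size. -/

section Main

open Metric

/-- With probability at least `1 - exp (-τ)` the accuracy certificate of the robust mirror descent
is bounded uniformly in the test point. -/
theorem exists_event_accuracyCertificate_le
    {E : Type*} [NormedAddCommGroup E] [NormedSpace ℝ E] [FiniteDimensional ℝ E]
    [MeasurableSpace E] [BorelSpace E]
    {Ω : Type*} [MeasurableSpace Ω] {P : Measure Ω} [IsProbabilityMeasure P]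
    {X : Set E} {φ' : E → StrongDual ℝ E} {ψ : E → ℝ}
    {G : E → Ω → StrongDual ℝ E} {θ : E → ℝ} {θ' : E → StrongDual ℝ E}
    {x₀ xbar : E} {g : StrongDual ℝ E} {L R σ υ τ β K : ℝ} {N : ℕ}
    (hX : IsCompact X) (hx₀ : x₀ ∈ X) (hR : 0 < R) (hXR : ∀ x ∈ X, ‖x - x₀‖ ≤ R)
    (hL : 0 ≤ L) (hφ : ContinuousOn φ' X)
    (hlip : ∀ x ∈ X, ∀ x' ∈ X, ‖φ' x' - φ' x‖ ≤ L * ‖x - x'‖)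
    (hψ : ConvexOn ℝ X ψ) (hψc : ContinuousOn ψ X)
    (hG : IsStochasticOracle P X φ' G σ) (hυ : 0 ≤ υ * σ) (hxbar : xbar ∈ X)
    (hg : ‖g - φ' xbar‖ ≤ υ * σ) (hθ : IsNormalizedProxy θ θ') (hN : 1 ≤ N) (hβ : 0 < β)
    (hK : 0 < K) (hLK : L * R ≤ K) (hυK : υ * σ ≤ K) (hσK : σ ^ 2 ≤ τ / N * K ^ 2) :
    ∃ A : Set (Fin N → Ω), MeasurableSet A ∧
      1 - Real.exp (-τ) ≤ (Measure.pi fun _ : Fin N => P).real A ∧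
      ∀ w ∈ A, ∀ u ∈ X,
        accuracyCertificate φ' ψ (scaledProxy θ x₀ R) (scaledProxyGrad θ' x₀ R) (fun _ => β)
          (rsmd X ψ θ θ' x₀ R G g xbar L (K + υ * σ) υ σ (fun _ : Fin N => β) w) u
        ≤ 2 * (R ^ 2 * proxyRange θ) + β⁻¹ * (48 * (K * τ) * R + 288 * β⁻¹ * (K ^ 2 * τ)) := by
  have hN' : (0 : ℝ) < N := by exact_mod_cast hN
  have hp := hθ.isProxProblem hR hX hx₀ hXR hψ hψc
  have hp0 := hθ.isProxProblem hR hX hx₀ hXR (convexOn_const (0 : ℝ) hψ.1) continuousOn_const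
  set v := scaledProxy θ x₀ R
  set v' := scaledProxyGrad θ' x₀ R
  set y := truncatedGrad G g xbar L (K + υ * σ) υ σ with hy
  set κ := 3 / 2 * β⁻¹ with hκ
  have hκ0 : 0 < κ := by positivity
  set t := (32 * K * R + 128 * κ * K ^ 2)⁻¹ with ht
  have hD : 0 < 32 * K * R + 128 * κ * K ^ 2 := by positivity
  have ht0 : 0 < t := inv_pos.2 hD
  have hym : Measurable fun p : ProxState x₀ R v X × Ω => y p.1 p.2 :=
    measurable_truncatedGrad Set.inter_subset_left hG.measurable _ _ _ _ _ _
  let c₀ : ProxState x₀ R v X := ⟨x₀, hx₀, hp.proxy.center_mem⟩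
  have dist_le : ∀ a ∈ X, ∀ b ∈ X, ‖a - b‖ ≤ 2 * R := fun a ha b hb => by
    have h1 := norm_sub_le_norm_sub_add_norm_sub a x₀ b
    rw [norm_sub_rev x₀ b] at h1
    linarith [hXR a ha, hXR b hb]
  have hexp : ∀ s : ProxState x₀ R v X × ProxState x₀ R v X,
      ∫⁻ ω, ENNReal.ofReal (Real.exp (t * deviation y φ' κ s ω)) ∂P
        ≤ ENNReal.ofReal (Real.exp (τ / N / 2)) := by
    rintro ⟨⟨x, hx, -⟩, ⟨z, hz, -⟩⟩
    have h1 : L * ‖xbar - x‖ ≤ 2 * K := by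
      have := mul_le_mul_of_nonneg_left (dist_le xbar hxbar x hx) hL
      linarith
    have hgx : ‖g - φ' x‖ ≤ L * ‖xbar - x‖ + υ * σ := by
      have h2 := norm_sub_le_norm_sub_add_norm_sub g (φ' xbar) (φ' x)
      have h3 := hlip x hx xbar hxbar
      rw [norm_sub_rev x] at h3
      linarith
    have hGx : Measurable (G x) := hG.measurable.comp
      (f := fun ω : Ω => ((⟨x, hx⟩ : X), ω)) measurable_prodMk_left
    -- Here `d ≤ 2K + υσ` and `l = K + υσ`, so `d ≤ 3l` and `2d + l ≤ 5K + 3υσ ≤ 8K`.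
    have := lintegral_exp_truncateAt_le (P := P) (l := K + υ * σ) (e := z - x) hR hK hκ0.le
      (by linarith) (by linarith) (by linarith) hσK (dist_le z hz x hx) hgx hGx
      (hG.integrable x hx) (hG.unbiased x hx) (hG.integrable_sq x hx) (hG.second_moment x hx)
    simpa only [deviation, gradError, hy, truncatedGrad_eq_truncateAt] using this
  obtain ⟨A, hAm, hAp, hA⟩ := exists_event_sum_chain_le
    (measurable_pairStep hp hp0 hβ hym hφ) ((measurable_deviation hym hφ κ).const_mul t)
    hexp N (c₀, c₀) τ
  refine ⟨A, hAm, hAp, fun w hw u hu => ?_⟩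
  have hsum := hA w hw
  set s := chain (pairStep hp hp0 hβ y φ') (c₀, c₀) w with hs
  have hx : rsmd X ψ θ θ' x₀ R G g xbar L (K + υ * σ) υ σ (fun _ : Fin N => β) w
      = fun i => ((s i).1 : E) :=
    funext fun i => mirrorDescent_eq_chain hp hp0 hβ y φ' (c₀, c₀) w i
  rw [hx]
  have hcert := accuracyCertificate_le (φ' := φ') hp hp0 hβ (x := fun i => ((s i).1 : E))
    (z := fun i => ((s i).2 : E)) (ξ := fun i => gradError y φ' (s i.castSucc).1 (w i))
    (fun i => (s i).1.2) (fun i => (s i).2.2)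
    (fun i => by
      simp only [hs, chain_succ, gradError, add_sub_cancel]
      rfl)
    (fun i => by
      simp only [hs, chain_succ]
      rfl) hu
  have hV : bregman v v' x₀ u ≤ R ^ 2 * proxyRange θ := hθ.bregman_center_le hR (hp.subset hu)
  -- The exponent is `N · τ/(2N) + τ = 3τ/2`. Multiplied by `32KR + 128κK²` with `κ = 3/(2β)`, it
  -- gives the constants 48 and 288.
  have hsum' : ∑ i : Fin N, deviation y φ' κ (s i.castSucc) (w i)
      ≤ 48 * (K * τ) * R + 288 * β⁻¹ * (K ^ 2 * τ) := by
    rw [← Finset.mul_sum, ht, inv_mul_le_iff₀ hD] at hsum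
    refine hsum.trans (le_of_eq ?_)
    rw [hκ]
    field_simp
    ring
  have h3 := mul_le_mul_of_nonneg_left hsum' (inv_nonneg.2 hβ.le)
  have e0 : ((s 0).1 : E) = x₀ := rfl
  have e1 : ((s 0).2 : E) = x₀ := rfl
  simp only [e0, e1] at hcert
  simp only [deviation, hκ] at h3
  linarith

theorem sqrt_div_mul_eq {a b : ℝ} (hb : 0 < b) : √(a / b) * b = √(b * a) := by
  rw [mul_comm b a]
  have : a * b = a / b * b ^ 2 := by field_simp
  rw [this, Real.sqrt_mul' _ (sq_nonneg b), Real.sqrt_sq hb.le]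

/-- The choice of the step size which balances the terms of the accuracy bound. -/
theorem balanced_bound_le {L R σ τ Θ β N : ℝ} (hL : 0 ≤ L) (hR : 0 < R) (hσ : 0 < σ)
    (hτ : 0 < τ) (hΘ : 0 < Θ) (hN : 0 < N) (hβ : β = max (2 * L) (σ * √N / (R * √Θ))) :
    288 / N * (β * R ^ 2 * Θ + R * max (σ * √(τ * N)) (L * R * τ)
        + β⁻¹ * max (N * σ ^ 2) ((L * R) ^ 2 * τ))
      ≤ max (2304 * (L * R ^ 2 * max τ Θ / N)) (2304 * (σ * R * √(max τ Θ / N))) := by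
  set m := max τ Θ
  set a := L * R ^ 2 * m / N with ha
  set b := σ * R * √(m / N) with hb
  have hm : 0 < m := hτ.trans_le (le_max_left _ _)
  have ha0 : 0 ≤ a := by positivity
  have hb0 : 0 ≤ b := by positivity
  set q := √N
  have hq : 0 < q := Real.sqrt_pos.2 hN
  have hqq : q ^ 2 = N := Real.sq_sqrt hN.le
  set f := √Θ
  have hf : 0 < f := Real.sqrt_pos.2 hΘ
  have hff : f ^ 2 = Θ := Real.sq_sqrt hΘ.le
  have hbq : b = σ * R * √m / q := by rw [hb, Real.sqrt_div hm.le, mul_div_assoc]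
  have hfm : f ≤ √m := Real.sqrt_le_sqrt (le_max_right _ _)
  have htm : √τ ≤ √m := Real.sqrt_le_sqrt (le_max_left _ _)
  have hfb : σ * R * f / q ≤ b := by rw [hbq]; gcongr
  have hβ1 : 2 * L ≤ β := hβ ▸ le_max_left _ _
  have hβ2 : σ * q / (R * f) ≤ β := hβ ▸ le_max_right _ _
  have hβ0 : 0 < β := lt_of_lt_of_le (by positivity) hβ2
  have t1 : β * R ^ 2 * Θ / N ≤ 2 * a + b := by
    have h1 : β ≤ 2 * L + σ * q / (R * f) := by
      rw [hβ]
      exact max_le (le_add_of_nonneg_right (by positivity)) (le_add_of_nonneg_left (by positivity))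
    calc _ ≤ (2 * L + σ * q / (R * f)) * R ^ 2 * Θ / N := by gcongr
      _ = 2 * (L * R ^ 2 * Θ / N) + σ * R * f / q := by
        rw [← hqq, ← hff]; field_simp
      _ ≤ 2 * a + b := by
        rw [ha]
        gcongr
        exact le_max_right _ _
  have t2 : R * max (σ * √(τ * N)) (L * R * τ) / N ≤ a + b := by
    rw [mul_max_of_nonneg _ _ hR.le, ← max_div_div_right hN.le]
    refine max_le ?_ ?_
    · refine le_trans (le_trans (le_of_eq ?_) (?_ : σ * R * √τ / q ≤ b)) (by linarith)
      · rw [Real.sqrt_mul hτ.le, ← hqq, Real.sqrt_sq hq.le]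
        field_simp
      · rw [hbq]; gcongr
    · refine le_trans (le_trans (le_of_eq ?_) (?_ : L * R ^ 2 * τ / N ≤ a)) (by linarith)
      · ring
      · rw [ha]; gcongr; exact le_max_left _ _
  have t3 : β⁻¹ * max (N * σ ^ 2) ((L * R) ^ 2 * τ) / N ≤ a + b := by
    rw [mul_max_of_nonneg _ _ (inv_pos.2 hβ0).le, ← max_div_div_right hN.le]
    refine max_le ?_ ?_
    · refine le_trans (le_trans ?_ hfb) (by linarith)
      calc β⁻¹ * (N * σ ^ 2) / N ≤ (σ * q / (R * f))⁻¹ * (N * σ ^ 2) / N := by gcongr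
        _ = σ * R * f / q := by field_simp
    · refine le_trans (?_ : _ ≤ a) (by linarith)
      have h1 : β⁻¹ * L ≤ 1 := by
        rw [inv_mul_le_iff₀ hβ0]; linarith
      calc β⁻¹ * ((L * R) ^ 2 * τ) / N = (β⁻¹ * L) * (L * R ^ 2 * τ / N) := by ring
        _ ≤ 1 * (L * R ^ 2 * m / N) := by
          gcongr
          exact le_max_left _ _
        _ = a := one_mul _
  have total : 288 / N * (β * R ^ 2 * Θ + R * max (σ * √(τ * N)) (L * R * τ)
        + β⁻¹ * max (N * σ ^ 2) ((L * R) ^ 2 * τ)) ≤ 288 * (4 * a + 3 * b) := by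
    calc _ = 288 * (β * R ^ 2 * Θ / N + R * max (σ * √(τ * N)) (L * R * τ) / N
        + β⁻¹ * max (N * σ ^ 2) ((L * R) ^ 2 * τ) / N) := by ring
      _ ≤ _ := by linarith
  refine total.trans ?_
  -- Since `4a + 3b ≤ 7 max(a, b)`, the constant `288 · 7 = 2016` would suffice.
  rcases le_total a b with hab | hab
  · exact le_max_of_le_right (by linarith)
  · exact le_max_of_le_left (by linarith)

end Main

theorem theorem1 :
    ∃ C C₁ C₂ : ℝ, 0 < C ∧ 0 < C₁ ∧ 0 < C₂ ∧
      ∀ (E : Type*) [NormedAddCommGroup E] [NormedSpace ℝ E] [FiniteDimensional ℝ E]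
        [MeasurableSpace E] [BorelSpace E]
        (Ω : Type*) [MeasurableSpace Ω] (P : Measure Ω) [IsProbabilityMeasure P]
        (X : Set E) (Φ : E → Ω → ℝ) (φ' : E → StrongDual ℝ E) (ψ : E → ℝ)
        (G : E → Ω → StrongDual ℝ E) (θ : E → ℝ) (θ' : E → StrongDual ℝ E)
        (x₀ xbar : E) (g : StrongDual ℝ E) (L R σ υ τ βbar : ℝ) (N : ℕ),
        Convex ℝ X → IsCompact X →
        x₀ ∈ X → 0 < R → (∀ x ∈ X, ‖x - x₀‖ ≤ R) →
        0 ≤ L → IsSmoothPart P X Φ φ' L →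
        ConvexOn ℝ X ψ → ContinuousOn ψ X →
        0 < σ → IsStochasticOracle P X φ' G σ →
        0 ≤ υ → xbar ∈ X → ‖g - φ' xbar‖ ≤ υ * σ →
        IsNormalizedProxy θ θ' →
        1 ≤ N → 1 ≤ τ → τ * υ ^ 2 ≤ N →
        0 < βbar → 2 * L ≤ βbar →
        let M : ℝ := L * R
        let lam : ℝ := max (σ * √(N / τ)) M + υ * σ
        let Θ : ℝ := proxyRange θ
        let F : E → ℝ := objective P Φ ψ
        let x : (Fin N → Ω) → Fin (N + 1) → E := fun w =>
          rsmd X ψ θ θ' x₀ R G g xbar L lam υ σ (fun _ => βbar) w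
        let xhat : (Fin N → Ω) → E := fun w => weightedAverage (fun _ => βbar) (x w)
        let ε : (Fin N → Ω) → E → ℝ := fun w z =>
          accuracyCertificate φ' ψ (scaledProxy θ x₀ R) (scaledProxyGrad θ' x₀ R)
            (fun _ => βbar) (x w) z
        ∃ A : Set (Fin N → Ω), MeasurableSet A ∧
          1 - 2 * Real.exp (-τ) ≤ (Measure.pi fun _ : Fin N => P).real A ∧
          ∀ w ∈ A,
            (∃ S : ℝ, IsLUB (ε w '' X) S ∧
              F (xhat w) - optimalValue F X ≤ βbar / N * S ∧
              βbar / N * S ≤ C / N * (βbar * R ^ 2 * Θ + R * max (σ * √(τ * N)) (M * τ)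
                + βbar⁻¹ * max (N * σ ^ 2) (M ^ 2 * τ))) ∧
            (βbar = max (2 * L) (σ * √N / (R * √Θ)) →
              F (xhat w) - optimalValue F X ≤
                max (C₁ * (L * R ^ 2 * max τ Θ / N)) (C₂ * (σ * R * √(max τ Θ / N)))) := by
  refine ⟨288, 2304, 2304, by norm_num, by norm_num, by norm_num, ?_⟩
  intro E _ _ _ _ _ Ω _ P _ X Φ φ' ψ G θ θ' x₀ xbar g L R σ υ τ β N _ hX hx₀ hR hXR hL hφ hψ
    hψc hσ hG hυ hxbar hg hθ hN hτ hτυ hβ hLβ M lam Θ F x xhat ε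
  have hN' : (0 : ℝ) < N := by exact_mod_cast hN
  have hτ0 : 0 < τ := by linarith
  set K := max (σ * √(N / τ)) M with hKdef
  have hKσ : σ * √(N / τ) ≤ K := le_max_left _ _
  have hK : 0 < K := lt_of_lt_of_le (by positivity) hKσ
  have hυK : υ * σ ≤ K := by
    refine le_trans ?_ hKσ
    rw [mul_comm]
    refine mul_le_mul_of_nonneg_left (Real.le_sqrt_of_sq_le ?_) hσ.le
    rw [le_div_iff₀ hτ0]
    linarith
  have hσK : σ ^ 2 ≤ τ / N * K ^ 2 := by
    calc σ ^ 2 = τ / N * (σ * √(N / τ)) ^ 2 := by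
          rw [mul_pow, Real.sq_sqrt (by positivity)]
          field_simp
      _ ≤ _ := by gcongr
  obtain ⟨A, hAm, hAp, hA⟩ := exists_event_accuracyCertificate_le hX hx₀ hR hXR hL
    hφ.continuousOn_grad hφ.lipschitz hψ hψc hG (by positivity) hxbar hg hθ hN hβ hK
    (le_max_right _ _) hυK hσK
  have hp := hθ.isProxProblem hR hX hx₀ hXR hψ hψc
  have hKτ : K * τ = max (σ * √(τ * N)) (M * τ) := by
    rw [hKdef, max_mul_of_nonneg _ _ hτ0.le, mul_assoc, sqrt_div_mul_eq hτ0]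
  have hK2τ : K ^ 2 * τ = max (N * σ ^ 2) (M ^ 2 * τ) := by
    have hM : 0 ≤ M := mul_nonneg hL hR.le
    have hs : 0 ≤ σ * √(N / τ) := by positivity
    have : K ^ 2 = max ((σ * √(N / τ)) ^ 2) (M ^ 2) := by
      rcases le_total (σ * √(N / τ)) M with h | h
      · rw [hKdef, max_eq_right h, max_eq_right (pow_le_pow_left₀ hs h 2)]
      · rw [hKdef, max_eq_left h, max_eq_left (pow_le_pow_left₀ hM h 2)]
    rw [this, max_mul_of_nonneg _ _ hτ0.le, mul_pow, Real.sq_sqrt (by positivity)]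
    congr 1
    field_simp
  -- The auxiliary descent merges all deviations into one sum, so a single failure probability
  -- `exp(-τ)` is spent.
  refine ⟨A, hAm, by linarith [Real.exp_pos (-τ)], fun w hw => ?_⟩
  have hbdd : BddAbove (ε w '' X) := ⟨_, by
    rintro _ ⟨u, hu, rfl⟩
    exact hA w hw u hu⟩
  have hlub := isLUB_csSup (Set.Nonempty.image (ε w) ⟨x₀, hx₀⟩) hbdd
  set S := sSup (ε w '' X)
  have hmem : ∀ i, x w i ∈ X ∩ subgradientDomain (Metric.closedBall x₀ R) (scaledProxy θ x₀ R) :=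
    fun i => Fin.cases ⟨hx₀, hp.proxy.center_mem⟩
      (fun _ => hp.compositeProx_mem hβ _ _) i
  have hFS : F (xhat w) - optimalValue F X ≤ β / N * S := by
    rw [sub_le_comm]
    refine le_csInf (Set.Nonempty.image F ⟨x₀, hx₀⟩) ?_
    rintro _ ⟨u, hu, rfl⟩
    have h1 := objective_weightedAverage_sub_le hφ hp hβ hLβ hN hmem hu
    have h2 := mul_le_mul_of_nonneg_left (hlub.1 (Set.mem_image_of_mem (ε w) hu))
      (by positivity : 0 ≤ β / N)
    change F (xhat w) - F u ≤ β / N * ε w u at h1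
    linarith
  have hΘ : 0 ≤ Θ := hθ.proxyRange_nonneg
  have hS : β / N * S ≤ 288 / N * (β * R ^ 2 * Θ + R * max (σ * √(τ * N)) (M * τ)
      + β⁻¹ * max (N * σ ^ 2) (M ^ 2 * τ)) := by
    rw [← hKτ, ← hK2τ]
    have h1 : S ≤ 2 * (R ^ 2 * Θ) + β⁻¹ * (48 * (K * τ) * R + 288 * β⁻¹ * (K ^ 2 * τ)) :=
      hlub.2 (by
        rintro _ ⟨u, hu, rfl⟩
        exact hA w hw u hu)
    calc β / N * S ≤ β / N * _ := mul_le_mul_of_nonneg_left h1 (by positivity)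
      _ = 1 / N * (2 * (β * R ^ 2 * Θ) + 48 * (R * (K * τ)) + 288 * (β⁻¹ * (K ^ 2 * τ))) := by
        field_simp
        ring
      _ ≤ 1 / N * (288 * (β * R ^ 2 * Θ) + 288 * (R * (K * τ)) + 288 * (β⁻¹ * (K ^ 2 * τ))) := by
        gcongr <;> norm_num
      _ = _ := by ring
  refine ⟨⟨S, hlub, hFS, hS⟩, fun hβeq => ?_⟩
  -- If `Θ = 0`, the quotient in the step size is a division by zero and the balancing breaks down.
  -- But then the divergence from `x₀` is at most zero on `X`, so `X` is a single point and the gap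
  -- vanishes.
  rcases hΘ.eq_or_lt with hΘ0 | hΘ0
  · have hXs : ∀ u ∈ X, u = x₀ := by
      intro u hu
      have h1 := hp.proxy.half_sq_le_bregman hp.proxy.center_mem (hp.subset hu)
      have h2 := hθ.bregman_center_le hR (hp.subset hu)
      change _ ≤ R ^ 2 * Θ at h2
      rw [← hΘ0, mul_zero] at h2
      have h3 : ‖u - x₀‖ ^ 2 = 0 := le_antisymm (by linarith) (sq_nonneg _)
      exact sub_eq_zero.1 (norm_eq_zero.1 (pow_eq_zero_iff two_ne_zero |>.1 h3))
    have hX1 : X = {x₀} := Set.eq_singleton_iff_unique_mem.2 ⟨hx₀, hXs⟩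
    have hxhat : xhat w = x₀ := by
      change (∑ _ : Fin N, β⁻¹)⁻¹ • ∑ i : Fin N, β⁻¹ • x w i.succ = x₀
      simp only [fun i => hXs _ (hmem i).1, ← Finset.sum_smul, smul_smul]
      rw [inv_mul_cancel₀, one_smul]
      simp [hN'.ne', hβ.ne']
    rw [hxhat, optimalValue, hX1, Set.image_singleton, csInf_singleton, sub_self]
    exact le_max_of_le_right (by positivity)
  · exact (hFS.trans hS).trans (balanced_bound_le hL hR hσ hτ0 hΘ0 hN' hβeq)
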